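/- Let $\lambda>3$ be an integer, let $\mathbb D=\{Z\in Mat_{2\times2}(\mathbb C): E-Z^*Z>0\}$ with the probability measure $d\mu_\lambda(Z)=\pi^{-4}(\lambda-1)(\lambda-2)^2(\lambda-3)\,[\det(E-Z^*Z)]^{\lambda-4}\,|dZ|$, where $|dZ|$ is Lebesgue measure, and let $L^2\mathcal O(\mathbb D,d\mu_\lambda)$ be the Hilbert space of square integrable holomorphic functions on $\mathbb D$. Let $\mathcal H$ be a complex Hilbert space identified with it by an anti-linear unitary $I:\mathcal H\to L^2\mathcal O(\mathbb D,d\mu_\lambda)$, and let the coherent state $|Z\rangle\in\mathcal H$, $Z\in\mathbb D$, be the vector with $\langle\psi|Z\rangle=(I\psi)(Z)$ for all $\psi\in\mathcal H$. For a bounded holomorphic function $f\in H^\infty(\mathbb D)$ let $a(f)$ be the unique bounded operator on $\mathcal H$ with $a(f)|Z\rangle=f(Z)|Z\rangle$ for all $Z\in\mathbb D$. Put $\mathcal P^{++}=a(H^\infty(\mathbb D))$; let $\mathcal P^{++}_{pol}$ be the norm-closed unital algebra generated by the four operators $a_{kl}=a(z_{kl})$, $k,l=1,2$; let $\mathcal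 M^{++}$ and $\mathcal M^{++}_{pol}$ be the $C^*$-algebras generated by $\mathcal P^{++}$ and $\mathcal P^{++}_{pol}$ respectively; and for a set $\mathcal P$ of operators write $\overline{\mathcal P}=\{x^*:x\in\mathcal P\}$. Let $L^0(\mathcal H)$ be the set of compact operators, and for a $C^*$-algebra $\mathcal M$ of operators let $Comm\,\mathcal M$ be its commutator ideal, i.e. the closed two-sided ideal of $\mathcal M$ generated by all commutators $xy-yx$, $x,y\in\mathcal M$. Then: (i) $\mathcal M^{++}_{pol}$ acts irreducibly on $\mathcal H$, and $\mathcal P^{++}_{pol}\cap\overline{\mathcal P^{++}_{pol}}=\mathbb C\,\mathbb I$. (ii) $\mathcal M^{++}_{pol}$ is dense in $B(\mathcal H)$ in the weak and in the strong operator topology. (iii) $\mathcal M^{++}_{pol}$ contains $L^0(\mathcal H)$, and so does every closed two-sided ideal of $\mathcal M^{++}_{pol}$ that acts irreducibly on $\mathcal H$. (iv) $\mathcal M^{++}_{pol}$ is conformally invariant: there is a unitary representation $U_\lambda$ of $SU(2,2)=\{g\in SL(4,\mathbb C): g^*\eta g=\eta\}$, $\eta=\mathrm{diag}(1,1,-1,-1)$,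 on $\mathcal H$ (the discrete series representation), determined by $(I\,U_\lambda(g)\psi)(Z)=[\det(CZ+D)]^{-\lambda}\,(I\psi)\big((AZ+B)(CZ+D)^{-1}\big)$ for $Z\in\mathbb D$, $\psi\in\mathcal H$, $g^{-1}=\begin{pmatrix}A&B\\C&D\end{pmatrix}$, and $U_\lambda(g)\,\mathcal M^{++}_{pol}\,U_\lambda(g)^*\subset\mathcal M^{++}_{pol}$ for all $g\in SU(2,2)$. (v) $\mathcal P^{++}_{pol}\cap L^0(\mathcal H)=\{0\}$. (vi) $L^0(\mathcal H)\subsetneq Comm\,\mathcal M^{++}_{pol}$. (vii) Statements (i), (ii), (iii), (v) and (vi) also hold with $\mathcal M^{++}$ and $\mathcal P^{++}$ in place of $\mathcal M^{++}_{pol}$ and $\mathcal P^{++}_{pol}$. -/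

import Mathlib

open MeasureTheory Filter Topology Metric
open scoped ComplexOrder ENNReal InnerProductSpace

noncomputable section
namespace ConformalToeplitz

/-- `2 × 2` complex matrices `Z = (z_{kl})`, as a normed space with its Lebesgue measure. -/
abbrev Mat2 : Type := Fin 2 → Fin 2 → ℂ

/-- The symmetric domain `𝔻 = {Z : E - Z* Z > 0}`. -/
def domainD : Set Mat2 :=
  {Z | (1 - (Matrix.of Z).conjTranspose * Matrix.of Z).PosDef}

/-- `det (E - Z* Z)`; it is real, since the matrix is Hermitian. -/
def weight (Z : Mat2) : ℝ :=
  (1 - (Matrix.of Z).conjTranspose * Matrix.of Z).det.re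

/-- The normalizing constant `c_λ = π⁻⁴ (λ - 1) (λ - 2)² (λ - 3)`. -/
def cConst (lam : ℕ) : ℝ :=
  (Real.pi ^ 4)⁻¹ * ((lam : ℝ) - 1) * ((lam : ℝ) - 2) ^ 2 * ((lam : ℝ) - 3)

/-- The measure `dμ_λ(Z) = c_λ det(E - Z* Z)^(λ-4) |dZ|` on `𝔻`, for an integer `λ > 3`. -/
def bergmanMeasure (lam : ℕ) : Measure Mat2 :=
  (volume.restrict domainD).withDensity
    fun Z => ENNReal.ofReal (cConst lam * weight Z ^ (lam - 4))

lemma isOpen_domainD : IsOpen domainD := by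
  have hcont : Continuous fun p : Mat2 × (Fin 2 → ℂ) =>
      (star p.2 ⬝ᵥ ((1 - (Matrix.of p.1).conjTranspose * Matrix.of p.1).mulVec p.2)).re := by
    refine Complex.continuous_re.comp ?_
    simp only [dotProduct, Matrix.mulVec, Matrix.mul_apply, Matrix.sub_apply, Fin.sum_univ_two,
      Matrix.conjTranspose_apply, Matrix.of_apply, Pi.star_apply, Matrix.one_apply]
    fun_prop
  have hH : ∀ Z : Mat2, (1 - (Matrix.of Z).conjTranspose * Matrix.of Z).IsHermitian := fun Z =>
    Matrix.isHermitian_one.sub (Matrix.isHermitian_conjTranspose_mul_self _)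
  have hset : domainD = {Z | ∀ v ∈ sphere (0 : Fin 2 → ℂ) 1,
      0 < (star v ⬝ᵥ ((1 - (Matrix.of Z).conjTranspose * Matrix.of Z).mulVec v)).re} := by
    ext Z
    simp only [domainD, Set.mem_ofPred_eq]
    rw [Matrix.posDef_iff_dotProduct_mulVec]
    constructor
    · intro h v hv
      have hv0 : v ≠ 0 := by
        rintro rfl
        simp at hv
      exact (Complex.pos_iff.1 (h.2 hv0)).1
    · intro h
      refine ⟨hH Z, fun v hv => ?_⟩
      have hn : 0 < ‖v‖ := norm_pos_iff.2 hv
      have := h (((‖v‖⁻¹ : ℝ) : ℂ) • v) (by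
        rw [mem_sphere_zero_iff_norm, norm_smul, Complex.norm_real, norm_inv, norm_norm,
          inv_mul_cancel₀ hn.ne'])
      rw [Matrix.mulVec_smul, star_smul, smul_dotProduct, dotProduct_smul, smul_smul,
        Complex.star_def, Complex.conj_ofReal, ← Complex.ofReal_mul, smul_eq_mul,
        Complex.re_ofReal_mul] at this
      have h2 : 0 < ‖v‖⁻¹ * ‖v‖⁻¹ := by positivity
      refine Complex.pos_iff.2 ⟨(pos_iff_pos_of_mul_pos this).1 h2, ?_⟩
      exact ((hH Z).im_star_dotProduct_mulVec_self v).symm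
  rw [hset, isOpen_iff_mem_nhds]
  intro Z hZ
  have hev : ∀ v ∈ sphere (0 : Fin 2 → ℂ) 1, ∀ᶠ p in 𝓝 (Z, v), 0 < (star p.2 ⬝ᵥ
      ((1 - (Matrix.of p.1).conjTranspose * Matrix.of p.1).mulVec p.2)).re := fun v hv =>
    (isOpen_lt continuous_const hcont).mem_nhds (hZ v hv)
  exact (isCompact_sphere (0 : Fin 2 → ℂ) 1).eventually_forall_of_forall_eventually hev

lemma continuous_weight : Continuous weight := by
  unfold weight
  refine Complex.continuous_re.comp ?_
  simp only [Matrix.det_fin_two, Matrix.mul_apply, Matrix.sub_apply, Fin.sum_univ_two,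
      Matrix.conjTranspose_apply, Matrix.of_apply, Matrix.one_apply]
  fun_prop

lemma weight_pos {Z : Mat2} (hZ : Z ∈ domainD) : 0 < weight Z :=
  (Complex.pos_iff.1 (Matrix.PosDef.det_pos hZ)).1

lemma cConst_pos (lam : ℕ) [h : Fact (3 < lam)] : 0 < cConst lam := by
  have : (3 : ℝ) < lam := by exact_mod_cast h.out
  unfold cConst
  have h1 : (0 : ℝ) < (lam : ℝ) - 1 := by linarith
  have h2 : (0 : ℝ) < (lam : ℝ) - 2 := by linarith
  have h3 : (0 : ℝ) < (lam : ℝ) - 3 := by linarith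
  positivity

lemma measurePreserving_rotate (u : Circle) :
    MeasurePreserving (fun W : Mat2 => (u : ℂ) • W) := by
  have h1 : MeasurePreserving (fun z : ℂ => (u : ℂ) * z) :=
    (rotation u).measurePreserving
  exact volume_preserving_pi (fun _ : Fin 2 => volume_preserving_pi (fun _ : Fin 2 => h1))

/-- Sub-mean value property of `|f|²` over polydiscs. -/
lemma enorm_sq_mul_volume_le {U : Set Mat2} (hU : IsOpen U) {f : Mat2 → ℂ}
    (hf : DifferentiableOn ℂ f U) {Z : Mat2} {r : ℝ} (hr : closedBall Z r ⊆ U) :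
    ‖f Z‖ₑ ^ 2 * volume (ball (0 : Mat2) r) ≤ ∫⁻ W in ball Z r, ‖f W‖ₑ ^ 2 := by
  classical
  set h : Mat2 → ℂ := U.piecewise f 0 with hh
  have hmeas : Measurable h := by
    refine ContinuousOn.measurable_piecewise hf.continuousOn continuousOn_const hU.measurableSet
  have heq : ∀ W ∈ U, h W = f W := fun W hW => Set.piecewise_eq_of_mem _ _ _ hW
  have key : ∀ W ∈ ball (0 : Mat2) r, ENNReal.ofReal (2 * Real.pi) * ‖f Z‖ₑ ^ 2 ≤
      ∫⁻ t in Set.Ioc 0 (2 * Real.pi), ‖h (Z + (Circle.exp t : ℂ) • W)‖ₑ ^ 2 := by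
    intro W hW
    have hW' : ‖W‖ < r := by simpa using hW
    have hin : ∀ z : ℂ, ‖z‖ ≤ 1 → Z + z • W ∈ U := fun z hz => hr (by
      rw [mem_closedBall, dist_eq_norm, add_sub_cancel_left, norm_smul]
      nlinarith [norm_nonneg W, norm_nonneg z])
    have hd : DiffContOnCl ℂ (fun z : ℂ => f (Z + z • W) ^ 2) (ball 0 |1|) := by
      apply DifferentiableOn.diffContOnCl
      intro z hz
      rw [abs_one, closure_ball _ one_ne_zero] at hz
      have hz' : ‖z‖ ≤ 1 := by simpa using hz
      refine DifferentiableAt.differentiableWithinAt ?_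
      have h1 : DifferentiableAt ℂ f (Z + z • W) :=
        (hf _ (hin z hz')).differentiableAt (hU.mem_nhds (hin z hz'))
      exact (h1.comp z (by fun_prop)).pow 2
    have hav := hd.circleAverage
    rw [Real.circleAverage_def] at hav
    simp only [zero_smul, add_zero] at hav
    have hpi : (0 : ℝ) < 2 * Real.pi := by positivity
    have h2 : (∫ t in (0)..(2 * Real.pi), f (Z + circleMap 0 1 t • W) ^ 2)
        = (2 * Real.pi : ℝ) • f Z ^ 2 := by
      rw [← hav, smul_smul, mul_inv_cancel₀ hpi.ne', one_smul]
    rw [intervalIntegral.integral_of_le hpi.le] at h2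
    have h3 := enorm_integral_le_lintegral_enorm (μ := volume.restrict (Set.Ioc 0 (2 * Real.pi)))
      (fun t => f (Z + circleMap 0 1 t • W) ^ 2)
    rw [h2, enorm_smul, enorm_pow] at h3
    rw [Real.enorm_of_nonneg hpi.le] at h3
    refine h3.trans (le_of_eq ?_)
    refine lintegral_congr fun t => ?_
    have hc : circleMap 0 1 t = (Circle.exp t : ℂ) := by simp [circleMap]
    rw [hc, heq _ (hin _ (by simp)), enorm_pow]
  have hjoint : Measurable fun p : Mat2 × ℝ => ‖h (Z + (Circle.exp p.2 : ℂ) • p.1)‖ₑ ^ 2 := by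
    refine ((hmeas.comp ?_).enorm).pow_const 2
    have : Continuous fun p : Mat2 × ℝ => Z + (Circle.exp p.2 : ℂ) • p.1 := by fun_prop
    exact this.measurable
  have hrot : ∀ t : ℝ, ∫⁻ W in ball (0 : Mat2) r, ‖h (Z + (Circle.exp t : ℂ) • W)‖ₑ ^ 2
      = ∫⁻ W in ball Z r, ‖f W‖ₑ ^ 2 := by
    intro t
    have hm : Measurable fun W : Mat2 => ‖h (Z + W)‖ₑ ^ 2 :=
      ((hmeas.comp (measurable_const_add Z)).enorm).pow_const 2
    have e1 := (measurePreserving_rotate (Circle.exp t)).setLIntegral_comp_preimage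
      (s := ball (0 : Mat2) r) measurableSet_ball hm
    have p1 : (fun W : Mat2 => (Circle.exp t : ℂ) • W) ⁻¹' ball 0 r = ball 0 r := by
      ext W; simp [norm_smul]
    rw [p1] at e1
    rw [e1]
    have e2 := (measurePreserving_add_left (volume : Measure Mat2) Z).setLIntegral_comp_preimage
      (s := ball Z r) measurableSet_ball ((hmeas.enorm).pow_const 2)
    have p2 : (fun W : Mat2 => Z + W) ⁻¹' ball Z r = ball 0 r := by
      ext W; simp [dist_eq_norm]
    rw [p2] at e2
    rw [e2]
    refine setLIntegral_congr_fun measurableSet_ball fun W hW => ?_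
    simp only [heq W (hr (ball_subset_closedBall hW))]
  have hpi : (0 : ℝ) < 2 * Real.pi := by positivity
  have step : ENNReal.ofReal (2 * Real.pi) * (‖f Z‖ₑ ^ 2 * volume (ball (0 : Mat2) r)) ≤
      ENNReal.ofReal (2 * Real.pi) * ∫⁻ W in ball Z r, ‖f W‖ₑ ^ 2 := by
    calc ENNReal.ofReal (2 * Real.pi) * (‖f Z‖ₑ ^ 2 * volume (ball (0 : Mat2) r))
        = ∫⁻ W in ball (0 : Mat2) r, ENNReal.ofReal (2 * Real.pi) * ‖f Z‖ₑ ^ 2 := by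
          rw [setLIntegral_const, mul_assoc]
      _ ≤ ∫⁻ W in ball (0 : Mat2) r, ∫⁻ t in Set.Ioc 0 (2 * Real.pi),
            ‖h (Z + (Circle.exp t : ℂ) • W)‖ₑ ^ 2 :=
          setLIntegral_mono' measurableSet_ball key
      _ = ∫⁻ t in Set.Ioc 0 (2 * Real.pi), ∫⁻ W in ball (0 : Mat2) r,
            ‖h (Z + (Circle.exp t : ℂ) • W)‖ₑ ^ 2 :=
          lintegral_lintegral_swap hjoint.aemeasurable
      _ = ENNReal.ofReal (2 * Real.pi) * ∫⁻ W in ball Z r, ‖f W‖ₑ ^ 2 := by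
          simp only [hrot]
          rw [setLIntegral_const, Real.volume_Ioc, sub_zero, mul_comm]
  exact (ENNReal.mul_le_mul_iff_right (by simpa using hpi) ENNReal.ofReal_ne_top).1 step

/-- Uniform local bound of a holomorphic function by its norm in `L²(𝔻, dμ_λ)`. -/
lemma exists_local_bound (lam : ℕ) [Fact (3 < lam)] {Z₀ : Mat2} (hZ₀ : Z₀ ∈ domainD) :
    ∃ r > 0, ∃ C : ℝ, 0 ≤ C ∧ ball Z₀ r ⊆ domainD ∧ ∀ f : Mat2 → ℂ,
      DifferentiableOn ℂ f domainD → ∀ Z ∈ ball Z₀ r,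
        ‖f Z‖ₑ ≤ ENNReal.ofReal C * eLpNorm f 2 (bergmanMeasure lam) := by
  obtain ⟨R, hR, hRU⟩ := nhds_basis_closedBall.mem_iff.1 (isOpen_domainD.mem_nhds hZ₀)
  set w : Mat2 → ℝ := fun Z => cConst lam * weight Z ^ (lam - 4) with hw
  have hwc : Continuous w := continuous_const.mul (continuous_weight.pow _)
  have hwpos : ∀ Z ∈ domainD, 0 < w Z := fun Z hZ =>
    mul_pos (cConst_pos lam) (pow_pos (weight_pos hZ) _)
  obtain ⟨Z₁, hZ₁, hmin⟩ := (isCompact_closedBall Z₀ R).exists_isMinOn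
    ⟨Z₀, mem_closedBall_self hR.le⟩ hwc.continuousOn
  set m : ℝ := w Z₁
  have hm : 0 < m := hwpos _ (hRU hZ₁)
  set r : ℝ := R / 2 with hr
  have hrpos : 0 < r := by positivity
  set V : ℝ := (volume (ball (0 : Mat2) r)).toReal
  have hVfin : volume (ball (0 : Mat2) r) ≠ ∞ := measure_ball_lt_top.ne
  have hV : 0 < V := ENNReal.toReal_pos (measure_ball_pos _ _ hrpos).ne' hVfin
  refine ⟨r, hrpos, Real.sqrt ((m * V)⁻¹), Real.sqrt_nonneg _, fun Z hZ => hRU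
    (ball_subset_closedBall (ball_subset_ball (by linarith) hZ)), fun f hf Z hZ => ?_⟩
  have hsub : closedBall Z r ⊆ closedBall Z₀ R := by
    intro W hW
    rw [mem_closedBall] at *
    rw [mem_ball] at hZ
    linarith [dist_triangle W Z Z₀]
  have h1 := enorm_sq_mul_volume_le isOpen_domainD hf (hsub.trans hRU)
  have h2 : ENNReal.ofReal m * ∫⁻ W in ball Z r, ‖f W‖ₑ ^ 2 ≤
      ∫⁻ W, ‖f W‖ₑ ^ 2 ∂(bergmanMeasure lam) := by
    unfold bergmanMeasure
    rw [lintegral_withDensity_eq_lintegral_mul_non_measurable _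
      (hwc.measurable.ennreal_ofReal) (Eventually.of_forall fun _ => ENNReal.ofReal_lt_top)]
    rw [← lintegral_const_mul' _ _ ENNReal.ofReal_ne_top]
    calc ∫⁻ W in ball Z r, ENNReal.ofReal m * ‖f W‖ₑ ^ 2
        ≤ ∫⁻ W in ball Z r, ENNReal.ofReal (w W) * ‖f W‖ₑ ^ 2 := by
          refine setLIntegral_mono' measurableSet_ball fun W hW => ?_
          gcongr
          exact hmin (hsub (ball_subset_closedBall hW))
      _ ≤ ∫⁻ W in domainD, ENNReal.ofReal (w W) * ‖f W‖ₑ ^ 2 :=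
          lintegral_mono_set ((ball_subset_closedBall.trans hsub).trans hRU)
      _ = _ := rfl
  have h3 : eLpNorm f 2 (bergmanMeasure lam) ^ 2 = ∫⁻ W, ‖f W‖ₑ ^ 2 ∂(bergmanMeasure lam) := by
    rw [eLpNorm_eq_lintegral_rpow_enorm_toReal (by norm_num) (by norm_num)]
    simp only [ENNReal.toReal_ofNat, ENNReal.rpow_ofNat]
    rw [← ENNReal.rpow_natCast, ← ENNReal.rpow_mul]
    norm_num
  have h4 : ENNReal.ofReal (m * V) * ‖f Z‖ₑ ^ 2 ≤ eLpNorm f 2 (bergmanMeasure lam) ^ 2 := by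
    rw [h3]
    refine le_trans ?_ h2
    rw [ENNReal.ofReal_mul hm.le, mul_assoc]
    gcongr
    rw [ENNReal.ofReal_toReal hVfin, mul_comm]
    exact h1
  have hmV : 0 < m * V := mul_pos hm hV
  have h5 : ‖f Z‖ₑ ^ 2 ≤ (ENNReal.ofReal (Real.sqrt ((m * V)⁻¹)) *
      eLpNorm f 2 (bergmanMeasure lam)) ^ 2 := by
    rw [mul_pow, ← ENNReal.ofReal_pow (Real.sqrt_nonneg _), Real.sq_sqrt (by positivity),
      ENNReal.ofReal_inv_of_pos hmV]
    have h6 : ENNReal.ofReal (m * V) ≠ 0 := by simpa using hmV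
    calc ‖f Z‖ₑ ^ 2 = (ENNReal.ofReal (m * V))⁻¹ * (ENNReal.ofReal (m * V) * ‖f Z‖ₑ ^ 2) := by
          rw [← mul_assoc, ENNReal.inv_mul_cancel h6 ENNReal.ofReal_ne_top, one_mul]
      _ ≤ _ := by gcongr
  exact (ENNReal.pow_le_pow_left_iff two_ne_zero).1 h5

/-- Two holomorphic functions on `𝔻` that agree almost everywhere agree on `𝔻`. -/
lemma eqOn_of_ae_eq (lam : ℕ) [Fact (3 < lam)] {f g : Mat2 → ℂ}
    (hf : DifferentiableOn ℂ f domainD) (hg : DifferentiableOn ℂ g domainD)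
    (h : f =ᵐ[bergmanMeasure lam] g) : Set.EqOn f g domainD := by
  intro Z hZ
  obtain ⟨r, hr, C, hC, hsub, hb⟩ := exists_local_bound lam hZ
  have h1 := hb (f - g) (hf.sub hg) Z (mem_ball_self hr)
  have h2 : eLpNorm (f - g) 2 (bergmanMeasure lam) = 0 := by
    rw [eLpNorm_congr_ae (g := 0), eLpNorm_zero]
    filter_upwards [h] with W hW using by simp [hW]
  rw [h2, mul_zero] at h1
  have h3 : f Z - g Z = 0 := by simpa using h1
  exact sub_eq_zero.1 h3

/-- A pointwise limit on `𝔻` of a sequence of holomorphic functions that is locally uniformly Cauchy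
is holomorphic. -/
lemma differentiableOn_of_locally_cauchy {F : ℕ → Mat2 → ℂ} {f : Mat2 → ℂ} {Z₀ : Mat2} {r : ℝ}
    (hr : 0 < r) (hF : ∀ n, DifferentiableOn ℂ (F n) (ball Z₀ r))
    (hc : UniformCauchySeqOn F atTop (ball Z₀ r))
    (hlim : ∀ Z ∈ ball Z₀ r, Tendsto (fun n => F n Z) atTop (𝓝 (f Z))) :
    DifferentiableAt ℂ f Z₀ := by
  have hs2 : ball Z₀ (r / 2) ⊆ ball Z₀ r := ball_subset_ball (by linarith)
  have hdiff : ∀ n, ∀ Z ∈ ball Z₀ r, DifferentiableAt ℂ (F n) Z := fun n Z hZ =>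
    (hF n Z hZ).differentiableAt (isOpen_ball.mem_nhds hZ)
  have hbound : ∀ G : Mat2 → ℂ, DifferentiableOn ℂ G (ball Z₀ r) → ∀ C : ℝ, 0 ≤ C →
      (∀ Z ∈ ball Z₀ r, ‖G Z‖ ≤ C) → ∀ Z ∈ ball Z₀ (r / 2), ‖fderiv ℂ G Z‖ ≤ C / (r / 4) := by
    intro G hG C hC hGC Z hZ
    refine ContinuousLinearMap.opNorm_le_of_unit_norm (𝕜 := ℂ) (by positivity) fun v hv => ?_
    have hin : ∀ t : ℂ, ‖t‖ ≤ r / 4 → Z + t • v ∈ ball Z₀ r := fun t ht => by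
      rw [mem_ball, dist_eq_norm] at hZ ⊢
      have h1 : ‖Z + t • v - Z₀‖ ≤ ‖Z - Z₀‖ + ‖t • v‖ := by
        rw [add_sub_right_comm]
        exact norm_add_le _ _
      rw [norm_smul, hv, mul_one] at h1
      linarith
    have hGd : ∀ t : ℂ, ‖t‖ ≤ r / 4 → HasDerivAt (fun t : ℂ => G (Z + t • v))
        (fderiv ℂ G (Z + t • v) v) t := fun t ht => by
      have h1 := ((hG _ (hin t ht)).differentiableAt
        (isOpen_ball.mem_nhds (hin t ht))).hasFDerivAt
      have h2 : HasDerivAt (fun t : ℂ => Z + t • v) v t := by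
        simpa using ((hasDerivAt_id t).smul_const v).const_add Z
      exact h1.comp_hasDerivAt t h2
    have h3 : DiffContOnCl ℂ (fun t : ℂ => G (Z + t • v)) (ball 0 (r / 4)) := by
      apply DifferentiableOn.diffContOnCl
      intro t ht
      rw [closure_ball _ (by positivity), mem_closedBall_zero_iff] at ht
      exact (hGd t ht).differentiableAt.differentiableWithinAt
    have h4 := Complex.norm_deriv_le_of_forall_mem_sphere_norm_le (by positivity : 0 < r / 4) h3
      (fun t ht => hGC _ (hin t (mem_sphere_zero_iff_norm.1 ht).le))
    rw [(hGd 0 (by rw [norm_zero]; positivity)).deriv] at h4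
    simpa using h4
  have hcd : UniformCauchySeqOn (fun n => fderiv ℂ (F n)) atTop (ball Z₀ (r / 2)) := by
    rw [Metric.uniformCauchySeqOn_iff] at hc ⊢
    intro ε hε
    obtain ⟨N, hN⟩ := hc (ε * (r / 4) / 2) (by positivity)
    refine ⟨N, fun p hp q hq Z hZ => ?_⟩
    have h1 := hbound (F p - F q) ((hF p).sub (hF q)) (ε * (r / 4) / 2) (by positivity)
      (fun W hW => by
        have := hN p hp q hq W hW
        rw [dist_eq_norm] at this
        exact this.le) Z hZ
    rw [fderiv_sub (hdiff p Z (hs2 hZ)) (hdiff q Z (hs2 hZ))] at h1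
    rw [dist_eq_norm]
    refine h1.trans_lt ?_
    rw [div_lt_iff₀ (by positivity)]
    have : 0 < ε * (r / 4) := by positivity
    linarith
  have hlimd : ∀ Z ∈ ball Z₀ (r / 2), ∃ L, Tendsto (fun n => fderiv ℂ (F n) Z) atTop (𝓝 L) :=
    fun Z hZ => cauchySeq_tendsto_of_complete (hcd.cauchySeq hZ)
  choose! L hL using hlimd
  have hun : TendstoUniformlyOn (fun n => fderiv ℂ (F n)) L atTop (ball Z₀ (r / 2)) :=
    hcd.tendstoUniformlyOn_of_tendsto hL
  exact (hasFDerivAt_of_tendstoUniformlyOn isOpen_ball hun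
    (fun n Z hZ => (hdiff n Z (hs2 hZ)).hasFDerivAt) (fun Z hZ => hlim Z (hs2 hZ))
    (mem_ball_self (by positivity))).differentiableAt

/-- The Hilbert space `L²𝒪(𝔻, dμ_λ)` of (classes of) square integrable holomorphic functions. -/
def bergmanSpace (lam : ℕ) : Submodule ℂ (Lp ℂ 2 (bergmanMeasure lam)) where
  carrier := {ψ | ∃ f : Mat2 → ℂ, DifferentiableOn ℂ f domainD ∧ ψ =ᵐ[bergmanMeasure lam] f}
  add_mem' := by
    rintro ψ φ ⟨f, hf, hψ⟩ ⟨g, hg, hφ⟩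
    exact ⟨f + g, hf.add hg, (Lp.coeFn_add ψ φ).trans (hψ.add hφ)⟩
  zero_mem' := ⟨0, differentiableOn_const 0, Lp.coeFn_zero _ _ _⟩
  smul_mem' := by
    rintro c ψ ⟨f, hf, hψ⟩
    exact ⟨c • f, hf.const_smul c, (Lp.coeFn_smul c ψ).trans (hψ.const_smul c)⟩

/-- The holomorphic function on `𝔻` representing an element of `L²𝒪(𝔻, dμ_λ)`. -/
def holFun {lam : ℕ} (ψ : bergmanSpace lam) : Mat2 → ℂ := ψ.2.choose

lemma differentiableOn_holFun {lam : ℕ} (ψ : bergmanSpace lam) :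
    DifferentiableOn ℂ (holFun ψ) domainD := ψ.2.choose_spec.1

lemma ae_eq_holFun {lam : ℕ} (ψ : bergmanSpace lam) :
    (ψ : Lp ℂ 2 (bergmanMeasure lam)) =ᵐ[bergmanMeasure lam] holFun ψ := ψ.2.choose_spec.2

lemma holFun_add {lam : ℕ} [Fact (3 < lam)] (ψ φ : bergmanSpace lam) {Z : Mat2}
    (hZ : Z ∈ domainD) : holFun (ψ + φ) Z = holFun ψ Z + holFun φ Z :=
  eqOn_of_ae_eq lam (differentiableOn_holFun _)
    ((differentiableOn_holFun ψ).add (differentiableOn_holFun φ))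
    ((ae_eq_holFun (ψ + φ)).symm.trans ((Lp.coeFn_add _ _).trans
      ((ae_eq_holFun ψ).add (ae_eq_holFun φ)))) hZ

lemma holFun_smul {lam : ℕ} [Fact (3 < lam)] (c : ℂ) (ψ : bergmanSpace lam) {Z : Mat2}
    (hZ : Z ∈ domainD) : holFun (c • ψ) Z = c * holFun ψ Z :=
  eqOn_of_ae_eq lam (differentiableOn_holFun _)
    ((differentiableOn_holFun ψ).const_smul c)
    ((ae_eq_holFun (c • ψ)).symm.trans ((Lp.coeFn_smul _ _).trans
      ((ae_eq_holFun ψ).const_smul c))) hZ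

lemma exists_norm_holFun_le (lam : ℕ) [Fact (3 < lam)] {Z₀ : Mat2} (hZ₀ : Z₀ ∈ domainD) :
    ∃ r > 0, ∃ C : ℝ, 0 ≤ C ∧ ball Z₀ r ⊆ domainD ∧ ∀ ψ : bergmanSpace lam,
      ∀ Z ∈ ball Z₀ r, ‖holFun ψ Z‖ ≤ C * ‖ψ‖ := by
  obtain ⟨r, hr, C, hC, hsub, hb⟩ := exists_local_bound lam hZ₀
  refine ⟨r, hr, C, hC, hsub, fun ψ Z hZ => ?_⟩
  have h1 := hb _ (differentiableOn_holFun ψ) Z hZ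
  rw [← eLpNorm_congr_ae (ae_eq_holFun ψ), ← Lp.enorm_def] at h1
  have h2 : ENNReal.ofReal ‖holFun ψ Z‖ ≤ ENNReal.ofReal (C * ‖ψ‖) := by
    rw [ENNReal.ofReal_mul hC, ofReal_norm, Submodule.coe_norm, ofReal_norm]
    exact h1
  exact (ENNReal.ofReal_le_ofReal_iff (by positivity)).1 h2

lemma isClosed_bergmanSpace (lam : ℕ) [Fact (3 < lam)] :
    IsClosed (bergmanSpace lam : Set (Lp ℂ 2 (bergmanMeasure lam))) := by
  refine IsSeqClosed.isClosed fun ψ ψ₀ hψ hlim => ?_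
  set Ψ : ℕ → bergmanSpace lam := fun n => ⟨ψ n, hψ n⟩
  have hsubv : ∀ p q : ℕ, ∀ Z ∈ domainD, holFun (Ψ p - Ψ q) Z = holFun (Ψ p) Z - holFun (Ψ q) Z := by
    intro p q Z hZ
    have := holFun_add (Ψ p - Ψ q) (Ψ q) hZ
    rw [sub_add_cancel] at this
    rw [this, add_sub_cancel_right]
  have hcau := Metric.cauchySeq_iff.1 hlim.cauchySeq
  have hloc : ∀ Z₀ ∈ domainD, ∃ r > 0, ball Z₀ r ⊆ domainD ∧
      UniformCauchySeqOn (fun n => holFun (Ψ n)) atTop (ball Z₀ r) := by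
    intro Z₀ hZ₀
    obtain ⟨r, hr, C, hC, hsub, hb⟩ := exists_norm_holFun_le lam hZ₀
    refine ⟨r, hr, hsub, Metric.uniformCauchySeqOn_iff.2 fun ε hε => ?_⟩
    obtain ⟨N, hN⟩ := hcau (ε / (C + 1)) (by positivity)
    refine ⟨N, fun p hp q hq Z hZ => ?_⟩
    have h1 := hb (Ψ p - Ψ q) Z hZ
    rw [hsubv p q Z (hsub hZ)] at h1
    have h2 := hN p hp q hq
    rw [dist_eq_norm] at h2 ⊢
    have h3 : ‖Ψ p - Ψ q‖ = ‖ψ p - ψ q‖ := rfl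
    rw [h3] at h1
    rw [lt_div_iff₀ (by positivity)] at h2
    nlinarith [norm_nonneg (ψ p - ψ q)]
  have hpt : ∀ Z ∈ domainD, ∃ a, Tendsto (fun n => holFun (Ψ n) Z) atTop (𝓝 a) := by
    intro Z hZ
    obtain ⟨r, hr, hsub, hc⟩ := hloc Z hZ
    exact cauchySeq_tendsto_of_complete (hc.cauchySeq (mem_ball_self hr))
  choose! f hf using hpt
  refine ⟨f, fun Z hZ => ?_, ?_⟩
  · obtain ⟨r, hr, hsub, hc⟩ := hloc Z hZ
    exact (differentiableOn_of_locally_cauchy hr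
      (fun n => (differentiableOn_holFun _).mono hsub) hc
      (fun W hW => hf W (hsub hW))).differentiableWithinAt
  · obtain ⟨ns, hns, hae⟩ := (tendstoInMeasure_of_tendsto_Lp hlim).exists_seq_tendsto_ae
    have h1 : ∀ᵐ Z ∂(bergmanMeasure lam), ∀ n, ψ n Z = holFun (Ψ n) Z :=
      ae_all_iff.2 fun n => ae_eq_holFun (Ψ n)
    have h2 : ∀ᵐ Z ∂(bergmanMeasure lam), Z ∈ domainD :=
      (withDensity_absolutelyContinuous _ _).ae_le (ae_restrict_mem isOpen_domainD.measurableSet)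
    filter_upwards [hae, h1, h2] with Z h3 h4 h5
    refine tendsto_nhds_unique h3 ?_
    simp only [h4]
    exact (hf Z h5).comp hns.tendsto_atTop

instance instCompleteSpaceBergmanSpace (lam : ℕ) [Fact (3 < lam)] :
    CompleteSpace (bergmanSpace lam) :=
  (isClosed_bergmanSpace lam).completeSpace_coe

/-- Evaluation `ψ ↦ ψ(Z)` at a point `Z ∈ 𝔻`, a bounded linear functional on `L²𝒪(𝔻, dμ_λ)`. -/
def evalAt (lam : ℕ) [Fact (3 < lam)] (Z : domainD) : bergmanSpace lam →L[ℂ] ℂ :=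
  LinearMap.mkContinuousOfExistsBound
    { toFun := fun ψ => holFun ψ Z
      map_add' := fun ψ φ => holFun_add ψ φ Z.2
      map_smul' := fun c ψ => holFun_smul c ψ Z.2 }
    (by
      obtain ⟨r, hr, C, hC, hsub, hb⟩ := exists_norm_holFun_le lam Z.2
      exact ⟨C, fun ψ => hb ψ Z (mem_ball_self hr)⟩)

/-- The reproducing kernel `k_Z ∈ L²𝒪(𝔻, dμ_λ)`, i.e. `⟨k_Z, ψ⟩ = ψ(Z)` for every `ψ`. -/
def reproducingKernel (lam : ℕ) [Fact (3 < lam)] (Z : domainD) : bergmanSpace lam :=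
  (InnerProductSpace.toDual ℂ (bergmanSpace lam)).symm (evalAt lam Z)

lemma inner_reproducingKernel (lam : ℕ) [Fact (3 < lam)] (Z : domainD) (ψ : bergmanSpace lam) :
    ⟪reproducingKernel lam Z, ψ⟫_ℂ = holFun ψ Z := by
  rw [reproducingKernel, InnerProductSpace.toDual_symm_apply]
  rfl

/-- An anti-linear isometry satisfies `⟨I x, I y⟩ = ⟨y, x⟩`. -/
lemma inner_map_map_conj {lam : ℕ} {H : Type*} [NormedAddCommGroup H]
    [InnerProductSpace ℂ H] (I : H ≃ₗᵢ⋆[ℂ] bergmanSpace lam) (x y : H) :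
    ⟪I x, I y⟫_ℂ = ⟪y, x⟫_ℂ := by
  have hI : (RCLike.I : ℂ) = Complex.I := rfl
  have hs : I (Complex.I • y) = -(Complex.I • I y) := by
    rw [map_smulₛₗ, Complex.conj_I, neg_smul]
  rw [inner_eq_sum_norm_sq_div_four (I x) (I y), inner_eq_sum_norm_sq_div_four y x]
  have e1 : ‖I x + I y‖ = ‖y + x‖ := by rw [← map_add, I.norm_map, add_comm]
  have e2 : ‖I x - I y‖ = ‖y - x‖ := by rw [← map_sub, I.norm_map, norm_sub_rev]
  have e3 : ‖I x - (RCLike.I : ℂ) • I y‖ = ‖y - (RCLike.I : ℂ) • x‖ := by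
    have h1 : I x - Complex.I • I y = I (x + Complex.I • y) := by
      rw [map_add, hs, sub_eq_add_neg]
    have h2 : x + Complex.I • y = Complex.I • (y - Complex.I • x) := by
      rw [smul_sub, smul_smul, Complex.I_mul_I, neg_one_smul, sub_neg_eq_add, add_comm]
    rw [hI, h1, I.norm_map, h2, norm_smul, Complex.norm_I, one_mul]
  have e4 : ‖I x + (RCLike.I : ℂ) • I y‖ = ‖y + (RCLike.I : ℂ) • x‖ := by
    have h1 : I x + Complex.I • I y = I (x - Complex.I • y) := by
      rw [map_sub, hs, sub_neg_eq_add]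
    have h2 : x - Complex.I • y = -(Complex.I • (y + Complex.I • x)) := by
      rw [smul_add, smul_smul, Complex.I_mul_I, neg_one_smul, neg_add, neg_neg, sub_eq_add_neg,
        add_comm]
    rw [hI, h1, I.norm_map, h2, norm_neg, norm_smul, Complex.norm_I, one_mul]
  rw [e1, e2, e3, e4]

section QuantumPhaseSpace

variable {lam : ℕ} [Fact (3 < lam)] {H : Type*} [NormedAddCommGroup H] [InnerProductSpace ℂ H]

/-- The coherent state `|Z⟩ ∈ ℋ`, where the anti-linear unitary `I : ℋ → L²𝒪(𝔻, dμ_λ)` identifies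
`ψ ∈ ℋ` with the function `Z ↦ ⟨ψ | Z⟩` (see `inner_coherentState`). -/
def coherentState (I : H ≃ₗᵢ⋆[ℂ] bergmanSpace lam) (Z : domainD) : H :=
  I.symm (reproducingKernel lam Z)

lemma inner_coherentState (I : H ≃ₗᵢ⋆[ℂ] bergmanSpace lam) (ψ : H) (Z : domainD) :
    ⟪ψ, coherentState I Z⟫_ℂ = holFun (I ψ) Z := by
  rw [← inner_map_map_conj I, coherentState, I.apply_symm_apply, inner_reproducingKernel]

/-- The algebra `H^∞(𝔻)` of bounded holomorphic functions on `𝔻`. -/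
def boundedHolomorphic : Set (Mat2 → ℂ) :=
  {f | DifferentiableOn ℂ f domainD ∧ ∃ C : ℝ, ∀ Z ∈ domainD, ‖f Z‖ ≤ C}

/-- The four coordinate functions `f_{kl}(Z) = z_{kl}`. -/
def coordinateFunctions : Set (Mat2 → ℂ) :=
  {f | ∃ k l : Fin 2, f = fun Z => Z k l}

/-- The bounded operators `a(f)`, `f ∈ S`, determined by `a(f) |Z⟩ = f(Z) |Z⟩` for all `Z ∈ 𝔻`. -/
def annihilationOperators (I : H ≃ₗᵢ⋆[ℂ] bergmanSpace lam) (S : Set (Mat2 → ℂ)) :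
    Set (H →L[ℂ] H) :=
  {T | ∃ f ∈ S, ∀ Z : domainD, T (coherentState I Z) = f Z • coherentState I Z}

/-- The quantum Kähler polarization `𝒫⁺⁺ = a(H^∞(𝔻))`. -/
def polarization (I : H ≃ₗᵢ⋆[ℂ] bergmanSpace lam) : Set (H →L[ℂ] H) :=
  annihilationOperators I boundedHolomorphic

/-- `𝒫⁺⁺_pol`, the unital Banach algebra generated by the coordinate annihilation operators
`a_{kl} = a(f_{kl})`. -/
def polarizationPol (I : H ≃ₗᵢ⋆[ℂ] bergmanSpace lam) : Subalgebra ℂ (H →L[ℂ] H) :=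
  (Algebra.adjoin ℂ (annihilationOperators I coordinateFunctions)).topologicalClosure

/-- A set of operators acts irreducibly: `ℋ ≠ 0`, and `0` and `ℋ` are the only closed subspaces
invariant under all of them. -/
def ActsIrreducibly (A : Set (H →L[ℂ] H)) : Prop :=
  Nontrivial H ∧ ∀ K : Submodule ℂ H, IsClosed (K : Set H) →
    (∀ T ∈ A, ∀ x ∈ K, T x ∈ K) → K = ⊥ ∨ K = ⊤

/-- The set `L⁰(ℋ)` of compact operators. -/
def compactOperators (H : Type*) [NormedAddCommGroup H] [InnerProductSpace ℂ H] :
    Set (H →L[ℂ] H) :=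
  {T | IsCompactOperator T}

/-- The scalar operators `ℂ 𝕀`. -/
def scalarOperators (H : Type*) [NormedAddCommGroup H] [InnerProductSpace ℂ H] :
    Set (H →L[ℂ] H) :=
  Set.range fun c : ℂ => c • (1 : H →L[ℂ] H)

variable [CompleteSpace H]

/-- Every bounded holomorphic `f` gives rise to exactly one operator `a(f)`. -/
lemma existsUnique_annihilation (I : H ≃ₗᵢ⋆[ℂ] bergmanSpace lam) {f : Mat2 → ℂ}
    (hf : f ∈ boundedHolomorphic) :
    ∃! T : H →L[ℂ] H, ∀ Z : domainD, T (coherentState I Z) = f Z • coherentState I Z := by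
  obtain ⟨hfd, C, hC⟩ := hf
  have hae : ∀ᵐ Z ∂(bergmanMeasure lam), Z ∈ domainD :=
    (withDensity_absolutelyContinuous _ _).ae_le (ae_restrict_mem isOpen_domainD.measurableSet)
  have hfm : AEStronglyMeasurable f (bergmanMeasure lam) :=
    (hfd.continuousOn.aestronglyMeasurable isOpen_domainD.measurableSet).mono_ac
      (withDensity_absolutelyContinuous _ _)
  have hle : ∀ ψ : bergmanSpace lam, ∀ᵐ Z ∂(bergmanMeasure lam),
      ‖f Z * (ψ : Lp ℂ 2 (bergmanMeasure lam)) Z‖ ≤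
        C * ‖(ψ : Lp ℂ 2 (bergmanMeasure lam)) Z‖ := fun ψ => by
    filter_upwards [hae] with Z hZ
    rw [norm_mul]
    exact mul_le_mul_of_nonneg_right (hC Z hZ) (norm_nonneg _)
  have hmem : ∀ ψ : bergmanSpace lam,
      MemLp (fun Z => f Z * (ψ : Lp ℂ 2 (bergmanMeasure lam)) Z) 2 (bergmanMeasure lam) :=
    fun ψ => (Lp.memLp (ψ : Lp ℂ 2 (bergmanMeasure lam))).of_le_mul
      (hfm.mul (Lp.aestronglyMeasurable _)) (hle ψ)
  have hmul : ∀ ψ : bergmanSpace lam, (hmem ψ).toLp ∈ bergmanSpace lam := fun ψ =>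
    ⟨fun Z => f Z * holFun ψ Z, hfd.mul (differentiableOn_holFun ψ), by
      filter_upwards [(hmem ψ).coeFn_toLp, ae_eq_holFun ψ] with Z h1 h2
      rw [h1, h2]⟩
  have hhol : ∀ ψ : bergmanSpace lam, ∀ Z ∈ domainD,
      holFun (⟨(hmem ψ).toLp, hmul ψ⟩ : bergmanSpace lam) Z = f Z * holFun ψ Z := fun ψ Z hZ =>
    eqOn_of_ae_eq lam (differentiableOn_holFun _) (hfd.mul (differentiableOn_holFun ψ)) (by
      refine (ae_eq_holFun _).symm.trans ?_
      filter_upwards [(hmem ψ).coeFn_toLp, ae_eq_holFun ψ] with Z h1 h2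
      rw [h1, h2]
      rfl) hZ
  have hext : ∀ x y : H, (∀ Z : domainD, holFun (I x) Z = holFun (I y) Z) → x = y := by
    intro x y h
    refine I.injective (Subtype.ext (Lp.ext ?_))
    filter_upwards [ae_eq_holFun (I x), ae_eq_holFun (I y), hae] with Z h1 h2 h3
    rw [h1, h2, h ⟨Z, h3⟩]
  let S : H →ₗ[ℂ] H :=
    { toFun := fun x => I.symm ⟨(hmem (I x)).toLp, hmul (I x)⟩
      map_add' := fun x y => hext _ _ fun Z => by
        simp only [map_add, I.apply_symm_apply, holFun_add _ _ Z.2, hhol _ _ Z.2, mul_add]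
      map_smul' := fun c x => hext _ _ fun Z => by
        simp only [map_smulₛₗ, I.apply_symm_apply, holFun_smul _ _ Z.2, hhol _ _ Z.2,
          RingHom.id_apply]
        ring }
  have hS : ∀ x, ‖S x‖ ≤ C * ‖x‖ := fun x => by
    change ‖I.symm ⟨(hmem (I x)).toLp, hmul (I x)⟩‖ ≤ _
    rw [I.symm.norm_map, ← I.norm_map x, Submodule.coe_norm, Submodule.coe_norm]
    refine Lp.norm_le_mul_norm_of_ae_le_mul ?_
    filter_upwards [hle (I x), (hmem (I x)).coeFn_toLp] with Z h1 h2
    rw [h2]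
    exact h1
  let B : H →L[ℂ] H := S.mkContinuous C hS
  have hB : ∀ x, ∀ Z : domainD, holFun (I (B x)) Z = f Z * holFun (I x) Z := fun x Z => by
    change holFun (I (I.symm ⟨(hmem (I x)).toLp, hmul (I x)⟩)) Z = _
    rw [I.apply_symm_apply, hhol _ _ Z.2]
  refine ⟨ContinuousLinearMap.adjoint B, fun Z => ?_, fun T hT => ?_⟩
  · refine ext_inner_left ℂ fun x => ?_
    rw [ContinuousLinearMap.adjoint_inner_right, inner_smul_right, inner_coherentState,
      inner_coherentState, hB]
  · have h1 : ContinuousLinearMap.adjoint T = B := by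
      ext x
      refine hext _ _ fun Z => ?_
      rw [hB, ← inner_coherentState, ContinuousLinearMap.adjoint_inner_left, hT Z,
        inner_smul_right, inner_coherentState]
    rw [← h1, ContinuousLinearMap.adjoint_adjoint]

/-- The set of adjoints of the operators in `A`. -/
def adjointSet (A : Set (H →L[ℂ] H)) : Set (H →L[ℂ] H) :=
  ContinuousLinearMap.adjoint '' A

/-- The quantum Kähler phase space `ℳ⁺⁺`, the C*-algebra generated by `𝒫⁺⁺`. -/
def phaseSpace (I : H ≃ₗᵢ⋆[ℂ] bergmanSpace lam) : StarSubalgebra ℂ (H →L[ℂ] H) :=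
  (StarAlgebra.adjoin ℂ (polarization I)).topologicalClosure

/-- `ℳ⁺⁺_pol`, the C*-algebra generated by `𝒫⁺⁺_pol`. -/
def phaseSpacePol (I : H ≃ₗᵢ⋆[ℂ] bergmanSpace lam) : StarSubalgebra ℂ (H →L[ℂ] H) :=
  (StarAlgebra.adjoin ℂ (polarizationPol I : Set (H →L[ℂ] H))).topologicalClosure

/-- The elements of an ideal of the operator algebra `M`, as operators on `ℋ`. -/
def idealOperators {M : StarSubalgebra ℂ (H →L[ℂ] H)} (J : TwoSidedIdeal M) : Set (H →L[ℂ] H) :=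
  Subtype.val '' (J : Set M)

/-- The commutator ideal `Comm M`: the closed two-sided ideal of `M` generated by all commutators
of elements of `M`. -/
def commutatorIdeal (M : StarSubalgebra ℂ (H →L[ℂ] H)) : Set (H →L[ℂ] H) :=
  Subtype.val '' closure
    ((TwoSidedIdeal.span {x : M | ∃ a b : M, x = a * b - b * a} : TwoSidedIdeal M) : Set M)

/-- Density in `B(ℋ)` for the weak operator topology. -/
def WeaklyDense (A : Set (H →L[ℂ] H)) : Prop :=
  Dense (ContinuousLinearMapWOT.ofCLM '' A : Set (H →WOT[ℂ] H))

/-- Density in `B(ℋ)` for the strong operator topology. -/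
def StronglyDense (A : Set (H →L[ℂ] H)) : Prop :=
  Dense (ContinuousLinearMap.toPointwiseConvergenceCLM ℂ (RingHom.id ℂ) H H '' A :
    Set (H →Lₚₜ[ℂ] H))

end QuantumPhaseSpace

/-- The twistor form `η = diag(E, -E)` on `ℂ⁴`. -/
def twistorForm : Matrix (Fin 2 ⊕ Fin 2) (Fin 2 ⊕ Fin 2) ℂ := Matrix.fromBlocks 1 0 0 (-1)

/-- The conformal group `SU(2,2)`: the `g ∈ SL(4, ℂ)` with `g* η g = η`. -/
def SU22 : Subgroup (Matrix.SpecialLinearGroup (Fin 2 ⊕ Fin 2) ℂ) where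
  carrier := {g | g.1.conjTranspose * twistorForm * g.1 = twistorForm}
  mul_mem' := by
    intro a b ha hb
    simp only [Set.mem_ofPred_eq] at *
    change (a.1 * b.1).conjTranspose * twistorForm * (a.1 * b.1) = twistorForm
    rw [Matrix.conjTranspose_mul]
    calc _ = b.1.conjTranspose * (a.1.conjTranspose * twistorForm * a.1) * b.1 := by
          simp only [Matrix.mul_assoc]
      _ = _ := by rw [ha, hb]
  one_mem' := by simp
  inv_mem' := by
    intro a ha
    simp only [Set.mem_ofPred_eq] at *
    have h1 : a.1 * (a⁻¹).1 = 1 := congrArg Subtype.val (mul_inv_cancel a)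
    have h2 : (a⁻¹).1.conjTranspose * a.1.conjTranspose = 1 := by
      rw [← Matrix.conjTranspose_mul, h1, Matrix.conjTranspose_one]
    calc (a⁻¹).1.conjTranspose * twistorForm * (a⁻¹).1
        = (a⁻¹).1.conjTranspose * (a.1.conjTranspose * twistorForm * a.1) * (a⁻¹).1 := by rw [ha]
      _ = ((a⁻¹).1.conjTranspose * a.1.conjTranspose) * twistorForm * (a.1 * (a⁻¹).1) := by
          simp only [Matrix.mul_assoc]
      _ = twistorForm := by rw [h1, h2, Matrix.one_mul, Matrix.mul_one]

/-- `det (C Z + D)`, where `h = (A B; C D)`. -/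
def autFactor (h : Matrix (Fin 2 ⊕ Fin 2) (Fin 2 ⊕ Fin 2) ℂ) (Z : Mat2) : ℂ :=
  (h.toBlocks₂₁ * Matrix.of Z + h.toBlocks₂₂).det

/-- `(A Z + B) (C Z + D)⁻¹`, where `h = (A B; C D)`. -/
def moebius (h : Matrix (Fin 2 ⊕ Fin 2) (Fin 2 ⊕ Fin 2) ℂ) (Z : Mat2) : Mat2 :=
  Matrix.of.symm ((h.toBlocks₁₁ * Matrix.of Z + h.toBlocks₁₂) *
    (h.toBlocks₂₁ * Matrix.of Z + h.toBlocks₂₂)⁻¹)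

/-- `U` is the discrete series representation `U_λ` of `SU(2,2)` on `ℋ ≅ L²𝒪(𝔻, dμ_λ)`:
`(I U(g) ψ)(Z) = det(C Z + D)^(-λ) (I ψ)((A Z + B) (C Z + D)⁻¹)`, where `g⁻¹ = (A B; C D)`. -/
def IsDiscreteSeries {lam : ℕ} [Fact (3 < lam)] {H : Type*} [NormedAddCommGroup H]
    [InnerProductSpace ℂ H] [CompleteSpace H] (I : H ≃ₗᵢ⋆[ℂ] bergmanSpace lam)
    (U : SU22 →* unitary (H →L[ℂ] H)) : Prop :=
  ∀ (g : SU22) (ψ : H), ∀ Z ∈ domainD,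
    holFun (I ((U g : H →L[ℂ] H) ψ)) Z =
      ((autFactor (g⁻¹ : SU22).1.1 Z) ^ lam)⁻¹ * holFun (I ψ) (moebius (g⁻¹ : SU22).1.1 Z)

end ConformalToeplitz
end

open ConformalToeplitz

/-!
The coherent states satisfy `⟨W|Z⟩ = c · det(E - W*Z)^{-λ}`: moving `W` to the origin by `SU(2,2)`
reduces this to `⟨0|Z⟩ = c`, which holds because `⟨0|Z⟩` is a holomorphic function of `Z` invariant
under `Z ↦ uZ`, `|u| = 1`. Since `det(E - W*Z)` is a polynomial in the entries of `W*` and `Z`,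
multiplying the kernel of an operator by it stays inside `ℳ⁺⁺_pol`; doing so `λ` times to the
identity gives the rank-one operator `|0⟩⟨0|`. The automorphy factors and their inverses are symbols
of operators in `ℳ⁺⁺_pol`, so every `|W⟩⟨Z|` lies there as well, whence (i)-(iv).

For (v) and (vi), the normalized coherent states at `diag(t, 0)` tend weakly to zero as `|t| → 1`,
so a compact operator tends to zero on them. A compact `a(f)` therefore has `f` small on the circles
`|t| = r`, and `f(0) = 0` by the maximum principle; by conformal invariance `f = 0`. The commutator
of `a₂₂` and its adjoint does not tend to zero on these vectors.
-/

noncomputable section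

namespace ConformalToeplitz

section DenseSpan

open InnerProductSpace Set Submodule

variable {𝕜 E F ι κ : Type*} [RCLike 𝕜]
  [NormedAddCommGroup E] [InnerProductSpace 𝕜 E] [NormedAddCommGroup F] [InnerProductSpace 𝕜 F]
  {v : ι → E} {w : κ → F}

lemma mem_of_dense_span (hv : Dense (span 𝕜 (range v) : Set E)) {K : Submodule 𝕜 E}
    (hK : IsClosed (K : Set E)) (h : ∀ i, v i ∈ K) (x : E) : x ∈ K :=
  hK.closure_subset (hv.mono (span_le.2 (range_subset_iff.2 h)) x)

lemma eq_zero_of_dense_span (hv : Dense (span 𝕜 (range v) : Set E)) {x : E}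
    (h : ∀ i, ⟪x, v i⟫_𝕜 = 0) : x = 0 :=
  inner_self_eq_zero.1 (mem_of_dense_span hv (innerSL 𝕜 x).isClosed_ker h x)

lemma dense_span_of_forall_inner_eq_zero [CompleteSpace E]
    (h : ∀ x : E, (∀ i, ⟪x, v i⟫_𝕜 = 0) → x = 0) : Dense (span 𝕜 (range v) : Set E) := by
  rw [dense_iff_topologicalClosure_eq_top, topologicalClosure_eq_top_iff, eq_bot_iff]
  exact fun x hx => h x fun i => inner_left_of_mem_orthogonal (subset_span (mem_range_self i)) hx

lemma clm_eq_of_inner_eq (hv : Dense (span 𝕜 (range v) : Set E))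
    (hw : Dense (span 𝕜 (range w) : Set F)) {S T : E →L[𝕜] F}
    (h : ∀ j i, ⟪w j, S (v i)⟫_𝕜 = ⟪w j, T (v i)⟫_𝕜) : S = T :=
  ContinuousLinearMap.ext_on hv <| by
    rintro _ ⟨i, rfl⟩
    refine sub_eq_zero.1 (eq_zero_of_dense_span hw fun j => ?_)
    rw [inner_eq_zero_symm, inner_sub_right, h, sub_self]

lemma rankOne_mem_of_dense_span (hv : Dense (span 𝕜 (range v) : Set E))
    (hw : Dense (span 𝕜 (range w) : Set F)) {S : Submodule 𝕜 (F →L[𝕜] E)}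
    (hS : IsClosed (S : Set (F →L[𝕜] E))) (h : ∀ i j, rankOne 𝕜 (v i) (w j) ∈ S) (x : E) (y : F) :
    rankOne 𝕜 x y ∈ S := by
  have left (j : κ) : rankOne 𝕜 x (w j) ∈ S := by
    let K : Submodule 𝕜 E :=
      { carrier := {x | rankOne 𝕜 x (w j) ∈ S}
        add_mem' := fun ha hb => by simpa using S.add_mem ha hb
        zero_mem' := by simp
        smul_mem' := fun c a ha => by simpa using S.smul_mem c ha }
    exact mem_of_dense_span (K := K) hv (hS.preimage (by fun_prop)) (fun i => h i j) x
  let K : Submodule 𝕜 F :=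
    { carrier := {y | rankOne 𝕜 x y ∈ S}
      add_mem' := fun ha hb => by simpa using S.add_mem ha hb
      zero_mem' := by simp
      smul_mem' := fun c a ha => by simpa using S.smul_mem (star c) ha }
  exact mem_of_dense_span (K := K) hw (hS.preimage (rankOne 𝕜 x).continuous) left y

end DenseSpan

section RankOne

open InnerProductSpace Submodule

variable {𝕜 E F : Type*} [RCLike 𝕜]
  [NormedAddCommGroup E] [InnerProductSpace 𝕜 E] [NormedAddCommGroup F] [InnerProductSpace 𝕜 F]

lemma norm_sub_starProjection_le (K : Submodule 𝕜 F) [K.HasOrthogonalProjection] (x : F) {y : F}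
    (hy : y ∈ K) : ‖x - K.starProjection x‖ ≤ ‖x - y‖ := by
  rw [starProjection_minimal]
  exact ciInf_le (f := fun z : K => ‖x - z‖) ⟨0, Set.forall_mem_range.2 fun _ => norm_nonneg _⟩
    ⟨y, hy⟩

variable [CompleteSpace E] [CompleteSpace F] {S : Submodule 𝕜 (E →L[𝕜] F)}

lemma starProjection_comp_mem (h : ∀ x y, rankOne 𝕜 x y ∈ S) (K : Submodule 𝕜 F)
    [FiniteDimensional 𝕜 K] (T : E →L[𝕜] F) : K.starProjection ∘L T ∈ S := by
  rw [OrthonormalBasis.starProjection_eq_sum_rankOne (stdOrthonormalBasis 𝕜 K),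
    ContinuousLinearMap.finsetSum_comp]
  exact S.sum_mem fun i _ => by rw [rankOne_comp]; exact h _ _

/- A compact `T` is within `ε` of its compression to the span of an `ε`-net of `T (closedBall 0 1)`,
which has finite rank. -/
lemma mem_of_isCompactOperator (hS : IsClosed (S : Set (E →L[𝕜] F)))
    (h : ∀ x y, rankOne 𝕜 x y ∈ S) {T : E →L[𝕜] F} (hT : IsCompactOperator T) : T ∈ S := by
  refine hS.closure_subset_iff.2 subset_rfl (Metric.mem_closure_iff.2 fun ε hε => ?_)
  obtain ⟨t, ht, hcover⟩ := Metric.totallyBounded_iff.1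
    ((hT.isCompact_closure_image_closedBall 1).totallyBounded.subset subset_closure)
    (ε / 2) (half_pos hε)
  have : FiniteDimensional 𝕜 (span 𝕜 t) := .span_of_finite 𝕜 ht
  refine ⟨(span 𝕜 t).starProjection ∘L T, starProjection_comp_mem h _ T, ?_⟩
  rw [dist_eq_norm]
  refine (ContinuousLinearMap.opNorm_le_of_unit_norm (𝕜 := 𝕜) (half_pos hε).le fun x hx =>
    ?_).trans_lt (half_lt_self hε)
  obtain ⟨y, hy, hxy⟩ := Set.mem_iUnion₂.1 (hcover ⟨x, by simp [hx], rfl⟩)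
  rw [mem_ball, dist_eq_norm] at hxy
  exact (norm_sub_starProjection_le _ (T x) (subset_span hy)).trans hxy.le

end RankOne

section OperatorAlgebras

open InnerProductSpace Set Submodule

variable {H ι : Type*} [NormedAddCommGroup H] [InnerProductSpace ℂ H] {v : ι → H}

lemma weaklyDense_of_stronglyDense {A : Set (H →L[ℂ] H)} (h : StronglyDense A) :
    WeaklyDense A := by
  let φ : (H →Lₚₜ[ℂ] H) → (H →WOT[ℂ] H) := fun T => ContinuousLinearMapWOT.ofCLM (T : H →L[ℂ] H)
  have hφ : Continuous φ := ContinuousLinearMapWOT.continuous_of_dual_apply_continuous fun x y =>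
    y.continuous.comp (continuous_eval_const x)
  have hsurj : Function.Surjective φ := fun T => ⟨T.toCLM, rfl⟩
  have hdense := hsurj.denseRange.dense_image hφ h
  rwa [image_image] at hdense

lemma exists_ne_zero_of_actsIrreducibly {A : Set (H →L[ℂ] H)} (hA : ActsIrreducibly A)
    (hH : 1 < Module.rank ℂ H) : ∃ T ∈ A, T ≠ 0 := by
  by_contra! hzero
  obtain ⟨x, hx⟩ := @exists_ne H hA.1 0
  rcases hA.2 (ℂ ∙ x) (closed_of_finiteDimensional _) fun T hT y _ => by simp [hzero T hT]
    with hbot | htop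
  · exact hx (span_singleton_eq_bot.1 hbot)
  · refine hH.not_ge ?_
    rw [← rank_top ℂ H, ← htop]
    exact (rank_span_le {x}).trans (by simp)

lemma actsIrreducibly_of_rankOne_mem (hv : Dense (span ℂ (range v) : Set H)) [Nontrivial H]
    {A : Set (H →L[ℂ] H)} (h : ∀ i j, rankOne ℂ (v i) (v j) ∈ A) : ActsIrreducibly A := by
  refine ⟨inferInstance, fun K hK hA => or_iff_not_imp_left.2 fun hbot => ?_⟩
  obtain ⟨x, hx, hx0⟩ := exists_mem_ne_zero_of_ne_bot hbot
  obtain ⟨j, hj⟩ : ∃ j, ⟪x, v j⟫_ℂ ≠ 0 := by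
    by_contra! hx_perp
    exact hx0 (eq_zero_of_dense_span hv hx_perp)
  refine eq_top_iff'.2 (mem_of_dense_span hv hK fun i => ?_)
  have hi : ⟪v j, x⟫_ℂ • v i ∈ K := hA _ (h i j) x hx
  exact (K.smul_mem_iff (mt inner_eq_zero_symm.1 hj)).1 hi

variable [CompleteSpace H]

lemma stronglyDense_of_rankOne_mem {S : Submodule ℂ (H →L[ℂ] H)} (h : ∀ x y, rankOne ℂ x y ∈ S) :
    StronglyDense (S : Set (H →L[ℂ] H)) := by
  classical
  intro T
  have (s : Finset H) : FiniteDimensional ℂ (span ℂ (s : Set H)) := .span_finset ℂ s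
  refine mem_closure_of_tendsto (b := (atTop : Filter (Finset H)))
    (f := fun s : Finset H => ContinuousLinearMap.toPointwiseConvergenceCLM ℂ (RingHom.id ℂ) H H
      ((span ℂ (s : Set H)).starProjection ∘L (T : H →L[ℂ] H))) ?_
    (Eventually.of_forall fun s => ⟨_, starProjection_comp_mem h _ _, rfl⟩)
  rw [PointwiseConvergenceCLM.tendsto_iff_forall_tendsto]
  intro x
  refine tendsto_const_nhds.congr' ?_
  filter_upwards [eventually_ge_atTop {T x}] with s hs
  exact (starProjection_eq_self_iff.2 (subset_span (hs (Finset.mem_singleton_self _)))).symm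

section Ideals

variable {M : StarSubalgebra ℂ (H →L[ℂ] H)} (J : TwoSidedIdeal M)

/-- The operators in a two-sided ideal of an operator algebra, as a linear subspace of `B(ℋ)`. -/
def idealSubmodule : Submodule ℂ (H →L[ℂ] H) where
  carrier := idealOperators J
  add_mem' := by
    rintro _ _ ⟨a, ha, rfl⟩ ⟨b, hb, rfl⟩
    exact ⟨a + b, J.add_mem ha hb, rfl⟩
  zero_mem' := ⟨0, J.zero_mem, rfl⟩
  smul_mem' := by
    rintro c _ ⟨a, ha, rfl⟩
    exact ⟨c • a, by simpa using J.mul_mem_left (c • (1 : M)) a ha, rfl⟩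

variable {J}

lemma rankOne_mem_idealSubmodule (hM : ∀ x y, rankOne ℂ x y ∈ M) {a : M} (ha : a ∈ J)
    (ha0 : a ≠ 0) (x y : H) : rankOne ℂ x y ∈ idealSubmodule J := by
  obtain ⟨z, hz⟩ : ∃ z, (a : H →L[ℂ] H) z ≠ 0 := by
    by_contra! hzero
    exact ha0 (Subtype.ext (ContinuousLinearMap.ext hzero))
  let az : H := (a : H →L[ℂ] H) z
  have hmem : (⟨_, hM x az⟩ * a * ⟨_, hM z y⟩ : M) ∈ J :=
    J.mul_mem_right _ _ (J.mul_mem_left _ _ ha)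
  have hval : rankOne ℂ x az * (a : H →L[ℂ] H) * rankOne ℂ z y = ⟪az, az⟫_ℂ • rankOne ℂ x y := by
    ext u
    simp [az, smul_smul, mul_comm]
  refine ((idealSubmodule J).smul_mem_iff (inner_self_ne_zero (𝕜 := ℂ).2 hz)).1 ?_
  exact hval ▸ ⟨_, hmem, rfl⟩

lemma compactOperators_subset_closure_ideal (hMc : IsClosed (M : Set (H →L[ℂ] H)))
    (hM : ∀ x y, rankOne ℂ x y ∈ M) {a : M} (ha : a ∈ J) (ha0 : a ≠ 0) :
    compactOperators H ⊆ Subtype.val '' closure (J : Set M) := by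
  have hval : Topology.IsClosedEmbedding (Subtype.val : M → H →L[ℂ] H) :=
    hMc.isClosedEmbedding_subtypeVal
  rw [← hval.closure_image_eq]
  exact fun T hT => mem_of_isCompactOperator (isClosed_topologicalClosure (idealSubmodule J))
    (fun x y => le_topologicalClosure _ (rankOne_mem_idealSubmodule hM ha ha0 x y)) hT

lemma compactOperators_subset_idealOperators (hMc : IsClosed (M : Set (H →L[ℂ] H)))
    (hM : ∀ x y, rankOne ℂ x y ∈ M) (hH : 1 < Module.rank ℂ H) (hJ : IsClosed (J : Set M))
    (hirr : ActsIrreducibly (idealOperators J)) : compactOperators H ⊆ idealOperators J := by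
  obtain ⟨_, ⟨a, ha, rfl⟩, ha0⟩ := exists_ne_zero_of_actsIrreducibly hirr hH
  have hsub := compactOperators_subset_closure_ideal hMc hM ha (by simpa using ha0)
  rwa [hJ.closure_eq] at hsub

end Ideals

end OperatorAlgebras

section WeaklyNull

open Set Submodule

variable {𝕜 E F ι α : Type*} [RCLike 𝕜]
  [NormedAddCommGroup E] [InnerProductSpace 𝕜 E] [NormedAddCommGroup F] [InnerProductSpace 𝕜 F]
  {l : Filter α} {u : α → E} {C : ℝ}

lemma tendsto_inner_zero_of_dense_span {v : ι → E} (hv : Dense (span 𝕜 (range v) : Set E))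
    (hu : ∀ n, ‖u n‖ ≤ C) (hvu : ∀ i, Tendsto (fun n => ⟪v i, u n⟫_𝕜) l (𝓝 0)) (x : E) :
    Tendsto (fun n => ⟪x, u n⟫_𝕜) l (𝓝 0) := by
  let K : Submodule 𝕜 E :=
    { carrier := {x | Tendsto (fun n => ⟪x, u n⟫_𝕜) l (𝓝 0)}
      add_mem' := fun ha hb => by simpa [inner_add_left] using Tendsto.add ha hb
      zero_mem' := by simp [tendsto_const_nhds]
      smul_mem' := fun c a ha => by simpa [inner_smul_left] using Tendsto.const_mul (star c) ha }
  refine mem_of_dense_span (K := K) hv (isClosed_of_closure_subset fun y hy => ?_) hvu x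
  refine Metric.tendsto_nhds.2 fun ε hε => ?_
  obtain ⟨z, hz, hyz⟩ := Metric.mem_closure_iff.1 hy (ε / (2 * (|C| + 1))) (by positivity)
  have hz : Tendsto (fun n => ⟪z, u n⟫_𝕜) l (𝓝 0) := hz
  filter_upwards [Metric.tendsto_nhds.1 hz (ε / 2) (half_pos hε)] with n hn
  rw [dist_zero_right] at hn ⊢
  have hdiff : ‖⟪y - z, u n⟫_𝕜‖ ≤ ε / 2 := calc
    ‖⟪y - z, u n⟫_𝕜‖ ≤ ‖y - z‖ * ‖u n‖ := norm_inner_le_norm _ _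
    _ ≤ ε / (2 * (|C| + 1)) * (|C| + 1) := by
      gcongr
      · rw [← dist_eq_norm]; exact hyz.le
      · linarith [hu n, le_abs_self C]
    _ = ε / 2 := by field_simp
  have hsplit : ⟪y, u n⟫_𝕜 = ⟪y - z, u n⟫_𝕜 + ⟪z, u n⟫_𝕜 := by rw [← inner_add_left, sub_add_cancel]
  calc ‖⟪y, u n⟫_𝕜‖ ≤ ‖⟪y - z, u n⟫_𝕜‖ + ‖⟪z, u n⟫_𝕜‖ := hsplit ▸ norm_add_le _ _
    _ < ε := by linarith

lemma tendsto_apply_zero_of_isCompactOperator [CompleteSpace E] [CompleteSpace F] {T : E →L[𝕜] F}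
    (hT : IsCompactOperator T) (hu : ∀ n, ‖u n‖ ≤ C)
    (hw : ∀ x, Tendsto (fun n => ⟪x, u n⟫_𝕜) l (𝓝 0)) : Tendsto (fun n => T (u n)) l (𝓝 0) := by
  rw [tendsto_iff_ultrafilter]
  intro g hg
  obtain ⟨y, -, hy⟩ := (hT.isCompact_closure_image_closedBall C).ultrafilter_le_nhds
    (g.map fun n => T (u n)) (le_principal_iff.2 <| Filter.mem_map.2 <| univ_mem' fun n =>
      subset_closure ⟨u n, by simpa using hu n, rfl⟩)
  have hzero : ⟪y, y⟫_𝕜 = 0 := by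
    refine tendsto_nhds_unique (Tendsto.inner tendsto_const_nhds hy : Tendsto _ (g : Filter α) _) ?_
    simpa only [← ContinuousLinearMap.adjoint_inner_left] using
      (hw (ContinuousLinearMap.adjoint T y)).mono_left hg
  rwa [inner_self_eq_zero.1 hzero] at hy

end WeaklyNull

section Moebius

open Matrix

/-- `4 × 4` matrices in `2 × 2` blocks. -/
abbrev Mat22 : Type := Matrix (Fin 2 ⊕ Fin 2) (Fin 2 ⊕ Fin 2) ℂ

/-- Membership in `U(2,2)`: the matrix preserves the twistor form. -/
def IsTwistorUnitary (h : Mat22) : Prop := hᴴ * twistorForm * h = twistorForm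

lemma isTwistorUnitary_coe (g : SU22) : IsTwistorUnitary g.1.1 := g.2

/-- `A Z + B`, where `h = (A B; C D)`. -/
def numer (h : Mat22) (Z : Mat2) : Matrix (Fin 2) (Fin 2) ℂ :=
  h.toBlocks₁₁ * of Z + h.toBlocks₁₂

/-- `C Z + D`, where `h = (A B; C D)`. -/
def denom (h : Mat22) (Z : Mat2) : Matrix (Fin 2) (Fin 2) ℂ :=
  h.toBlocks₂₁ * of Z + h.toBlocks₂₂

/-- The kernel `det (E - W* Z)`. -/
def detKernel (W Z : Mat2) : ℂ := (1 - (of W)ᴴ * of Z).det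

lemma autFactor_eq (h : Mat22) (Z : Mat2) : autFactor h Z = (denom h Z).det := rfl

lemma of_moebius (h : Mat22) (Z : Mat2) : of (moebius h Z) = numer h Z * (denom h Z)⁻¹ := rfl

lemma mul_fromBlocks_one (h : Mat22) (Z : Mat2) : h * fromBlocks 1 (of Z) 0 1 =
    fromBlocks h.toBlocks₁₁ (numer h Z) h.toBlocks₂₁ (denom h Z) := by
  conv_lhs => rw [← fromBlocks_toBlocks h]
  simp [fromBlocks_multiply, numer, denom]

lemma moebius_one (Z : Mat2) : moebius 1 Z = Z := by
  refine of.injective ?_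
  rw [of_moebius, numer, denom, ← fromBlocks_one]
  simp only [toBlocks_fromBlocks₁₁, toBlocks_fromBlocks₁₂, toBlocks_fromBlocks₂₁,
    toBlocks_fromBlocks₂₂]
  simp

lemma autFactor_one (Z : Mat2) : autFactor 1 Z = 1 := by
  rw [autFactor, ← fromBlocks_one]
  simp only [toBlocks_fromBlocks₂₁, toBlocks_fromBlocks₂₂]
  simp

lemma differentiable_autFactor (h : Mat22) : Differentiable ℂ (autFactor h) := by
  unfold autFactor
  simp only [det_fin_two, Matrix.add_apply, Matrix.mul_apply, Fin.sum_univ_two, of_apply]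
  fun_prop

lemma detKernel_self {Z : Mat2} (hZ : Z ∈ domainD) : detKernel Z Z = weight Z :=
  Complex.ext rfl (Complex.pos_iff.1 (PosDef.det_pos hZ)).2.symm

lemma conjTranspose_fromBlocks_mul_twistorForm_mul (A B C D : Matrix (Fin 2) (Fin 2) ℂ) :
    (fromBlocks A B C D)ᴴ * twistorForm * fromBlocks A B C D =
      fromBlocks (Aᴴ * A - Cᴴ * C) (Aᴴ * B - Cᴴ * D) (Bᴴ * A - Dᴴ * C) (Bᴴ * B - Dᴴ * D) := by
  simp [twistorForm, fromBlocks_conjTranspose, fromBlocks_multiply, sub_eq_add_neg]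

lemma isTwistorUnitary_fromBlocks_iff {A B C D : Matrix (Fin 2) (Fin 2) ℂ} :
    IsTwistorUnitary (fromBlocks A B C D) ↔ Aᴴ * A - Cᴴ * C = 1 ∧ Aᴴ * B - Cᴴ * D = 0 ∧
      Bᴴ * A - Dᴴ * C = 0 ∧ Bᴴ * B - Dᴴ * D = -1 := by
  rw [IsTwistorUnitary, conjTranspose_fromBlocks_mul_twistorForm_mul, twistorForm, fromBlocks_inj]

namespace IsTwistorUnitary

variable {h : Mat22} (hh : IsTwistorUnitary h) {Z W : Mat2}
include hh

lemma toBlocks : h.toBlocks₁₁ᴴ * h.toBlocks₁₁ - h.toBlocks₂₁ᴴ * h.toBlocks₂₁ = 1 ∧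
    h.toBlocks₁₁ᴴ * h.toBlocks₁₂ - h.toBlocks₂₁ᴴ * h.toBlocks₂₂ = 0 ∧
    h.toBlocks₁₂ᴴ * h.toBlocks₁₁ - h.toBlocks₂₂ᴴ * h.toBlocks₂₁ = 0 ∧
    h.toBlocks₁₂ᴴ * h.toBlocks₁₂ - h.toBlocks₂₂ᴴ * h.toBlocks₂₂ = -1 :=
  isTwistorUnitary_fromBlocks_iff.1 (by rwa [fromBlocks_toBlocks])

lemma denom_sub_numer (Z W : Mat2) :
    (denom h W)ᴴ * denom h Z - (numer h W)ᴴ * numer h Z = 1 - (of W)ᴴ * of Z := by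
  obtain ⟨h₁₁, h₁₂, h₂₁, h₂₂⟩ := hh.toBlocks
  have hexpand : (denom h W)ᴴ * denom h Z - (numer h W)ᴴ * numer h Z =
      -(h.toBlocks₁₂ᴴ * h.toBlocks₁₂ - h.toBlocks₂₂ᴴ * h.toBlocks₂₂)
        - (of W)ᴴ * (h.toBlocks₁₁ᴴ * h.toBlocks₁₁ - h.toBlocks₂₁ᴴ * h.toBlocks₂₁) * of Z
        - (of W)ᴴ * (h.toBlocks₁₁ᴴ * h.toBlocks₁₂ - h.toBlocks₂₁ᴴ * h.toBlocks₂₂)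
        - (h.toBlocks₁₂ᴴ * h.toBlocks₁₁ - h.toBlocks₂₂ᴴ * h.toBlocks₂₁) * of Z := by
    simp only [numer, denom, conjTranspose_add, conjTranspose_mul]
    noncomm_ring
  simp [hexpand, h₁₁, h₁₂, h₂₁, h₂₂]

variable (hZ : Z ∈ domainD) (hW : W ∈ domainD)
include hZ

lemma isUnit_det_denom : IsUnit (denom h Z).det := by
  have hpos : ((denom h Z)ᴴ * denom h Z).PosDef := by
    rw [sub_eq_iff_eq_add.1 (hh.denom_sub_numer Z Z)]
    exact PosDef.add_posSemidef hZ (posSemidef_conjTranspose_mul_self _)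
  have hne := hpos.det_pos.ne'
  rw [det_mul] at hne
  exact isUnit_iff_ne_zero.2 (right_ne_zero_of_mul hne)

lemma autFactor_ne_zero : autFactor h Z ≠ 0 := (hh.isUnit_det_denom hZ).ne_zero

lemma moebius_mul_denom : of (moebius h Z) * denom h Z = numer h Z := by
  rw [of_moebius, nonsing_inv_mul_cancel_right _ _ (hh.isUnit_det_denom hZ)]

include hW in
lemma denom_mul_one_sub_mul_denom :
    (denom h W)ᴴ * (1 - (of (moebius h W))ᴴ * of (moebius h Z)) * denom h Z =
      1 - (of W)ᴴ * of Z := by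
  rw [← hh.denom_sub_numer Z W, ← hh.moebius_mul_denom hZ, ← hh.moebius_mul_denom hW,
    conjTranspose_mul]
  noncomm_ring

lemma moebius_mem : moebius h Z ∈ domainD := by
  have hu : IsUnit (denom h Z) := (isUnit_iff_isUnit_det _).2 (hh.isUnit_det_denom hZ)
  have hiff := hu.posDef_star_left_conjugate_iff
    (x := 1 - (of (moebius h Z))ᴴ * of (moebius h Z))
  rw [star_eq_conjTranspose, hh.denom_mul_one_sub_mul_denom hZ hZ] at hiff
  exact hiff.1 hZ

include hW in
lemma detKernel_moebius : star (autFactor h W) * autFactor h Z *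
    detKernel (moebius h W) (moebius h Z) = detKernel W Z := by
  rw [detKernel, detKernel, ← hh.denom_mul_one_sub_mul_denom hZ hW, det_mul, det_mul,
    det_conjTranspose, autFactor_eq, autFactor_eq]
  ring

lemma weight_moebius : ‖autFactor h Z‖ ^ 2 * weight (moebius h Z) = weight Z := by
  have hK := hh.detKernel_moebius hZ hZ
  rw [detKernel_self hZ, detKernel_self (hh.moebius_mem hZ), Complex.star_def,
    Complex.conj_mul'] at hK
  exact_mod_cast hK

lemma numer_mul (h' : Mat22) : numer (h' * h) Z = numer h' (moebius h Z) * denom h Z := by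
  have hblocks := mul_fromBlocks_one (h' * h) Z
  rw [Matrix.mul_assoc, mul_fromBlocks_one, ← fromBlocks_toBlocks h', fromBlocks_multiply,
    fromBlocks_inj, fromBlocks_toBlocks] at hblocks
  rw [← hblocks.2.1, numer.eq_1 h', Matrix.add_mul, Matrix.mul_assoc, hh.moebius_mul_denom hZ]

lemma denom_mul (h' : Mat22) : denom (h' * h) Z = denom h' (moebius h Z) * denom h Z := by
  have hblocks := mul_fromBlocks_one (h' * h) Z
  rw [Matrix.mul_assoc, mul_fromBlocks_one, ← fromBlocks_toBlocks h', fromBlocks_multiply,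
    fromBlocks_inj, fromBlocks_toBlocks] at hblocks
  rw [← hblocks.2.2.2, denom.eq_1 h', Matrix.add_mul, Matrix.mul_assoc, hh.moebius_mul_denom hZ]

lemma autFactor_mul (h' : Mat22) :
    autFactor (h' * h) Z = autFactor h' (moebius h Z) * autFactor h Z := by
  rw [autFactor_eq, hh.denom_mul hZ, det_mul, ← autFactor_eq, ← autFactor_eq]

lemma moebius_mul (h' : Mat22) : moebius (h' * h) Z = moebius h' (moebius h Z) := by
  refine of.injective ?_
  rw [of_moebius, of_moebius, hh.numer_mul hZ, hh.denom_mul hZ, Matrix.mul_inv_rev,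
    Matrix.mul_assoc, mul_nonsing_inv_cancel_left _ _ (hh.isUnit_det_denom hZ)]

end IsTwistorUnitary

end Moebius

section MoebiusDerivative

open Matrix

/-- The linear map `X ↦ L X R` on `2 × 2` matrices. -/
def sandwich (L R : Matrix (Fin 2) (Fin 2) ℂ) : Mat2 →L[ℂ] Mat2 :=
  LinearMap.toContinuousLinearMap
    { toFun := fun X => of.symm (L * of X * R)
      map_add' := fun X Y => by rw [← of_add_of, Matrix.mul_add, Matrix.add_mul]; rfl
      map_smul' := fun c X => by rw [← smul_of, Matrix.mul_smul, Matrix.smul_mul]; rfl }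

lemma of_sandwich_apply (L R : Matrix (Fin 2) (Fin 2) ℂ) (X : Mat2) :
    of (sandwich L R X) = L * of X * R := rfl

lemma det_sandwich (L R : Matrix (Fin 2) (Fin 2) ℂ) :
    LinearMap.det (sandwich L R : Mat2 →ₗ[ℂ] Mat2) = L.det ^ 2 * R.det ^ 2 := by
  have hkron : (sandwich L R : Mat2 →ₗ[ℂ] Mat2) =
      (LinearEquiv.curry ℂ ℂ (Fin 2) (Fin 2)).toLinearMap ∘ₗ
        toLin' (kroneckerMap (· * ·) L Rᵀ) ∘ₗ
        (LinearEquiv.curry ℂ ℂ (Fin 2) (Fin 2)).symm.toLinearMap := by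
    refine LinearMap.ext fun X => funext fun i => funext fun j => ?_
    change (L * of X * R) i j = (kroneckerMap (· * ·) L Rᵀ *ᵥ fun p => X p.1 p.2) (i, j)
    simp only [Matrix.mul_apply, Fin.sum_univ_two, Fintype.sum_prod_type, mulVec, dotProduct,
      kroneckerMap_apply, transpose_apply, of_apply]
    ring
  rw [hkron, LinearMap.det_conj, LinearMap.det_toLin', det_kronecker, det_transpose]
  simp

lemma hasFDerivAt_of_eventually_sub_eq {𝕜 E F : Type*} [NontriviallyNormedField 𝕜]
    [NormedAddCommGroup E] [NormedSpace 𝕜 E] [NormedAddCommGroup F] [NormedSpace 𝕜 F]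
    {f : E → F} {Φ : E → E →L[𝕜] F} {x : E} (hΦ : ContinuousAt Φ x)
    (h : ∀ᶠ y in 𝓝 x, f y - f x = Φ y (y - x)) : HasFDerivAt f (Φ x) x := by
  refine .of_isLittleO (Asymptotics.isLittleO_iff.2 fun c hc => ?_)
  filter_upwards [h, Metric.continuousAt_iff'.1 hΦ c hc] with y hy hyc
  rw [hy, ← _root_.sub_apply]
  exact (Φ y - Φ x).le_of_opNorm_le (dist_eq_norm (Φ y) (Φ x) ▸ hyc.le) _

/-- The derivative `X ↦ (A - M(Z) C) X (C Z + D)⁻¹` of `M = moebius h` at `Z`. -/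
def moebiusDeriv (h : Mat22) (Z : Mat2) : Mat2 →L[ℂ] Mat2 :=
  sandwich (h.toBlocks₁₁ - of (moebius h Z) * h.toBlocks₂₁) (denom h Z)⁻¹

namespace IsTwistorUnitary

variable {h : Mat22} (hh : IsTwistorUnitary h) {Z W : Mat2}
include hh

lemma moebius_sub_moebius (hZ : Z ∈ domainD) (hW : W ∈ domainD) :
    moebius h W - moebius h Z =
      sandwich (h.toBlocks₁₁ - of (moebius h Z) * h.toBlocks₂₁) (denom h W)⁻¹ (W - Z) := by
  refine of.injective ?_
  have hnum : numer h W = numer h Z + h.toBlocks₁₁ * (of W - of Z) := by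
    simp only [numer]
    noncomm_ring
  have hden : denom h W = denom h Z + h.toBlocks₂₁ * (of W - of Z) := by
    simp only [denom]
    noncomm_ring
  have hcross : numer h W - of (moebius h Z) * denom h W =
      (h.toBlocks₁₁ - of (moebius h Z) * h.toBlocks₂₁) * (of W - of Z) := by
    rw [hnum, hden, ← hh.moebius_mul_denom hZ]
    noncomm_ring
  rw [of_sandwich_apply, ← of_sub_of, ← of_sub_of, ← hcross, Matrix.sub_mul, ← of_moebius,
    mul_nonsing_inv_cancel_right _ _ (hh.isUnit_det_denom hW)]

lemma continuousOn_inv_denom : ContinuousOn (fun Z => (denom h Z)⁻¹) domainD := by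
  have hden : Continuous (denom h) := by
    unfold denom
    exact (continuous_const.matrix_mul continuous_id).add continuous_const
  simp only [inv_def, Ring.inverse_eq_inv']
  exact (hden.matrix_det.continuousOn.inv₀ fun Z hZ => hh.autFactor_ne_zero hZ).smul
    hden.matrix_adjugate.continuousOn

lemma hasFDerivAt_moebius (hZ : Z ∈ domainD) :
    HasFDerivAt (moebius h) (moebiusDeriv h Z) Z := by
  have hnhds := isOpen_domainD.mem_nhds hZ
  refine hasFDerivAt_of_eventually_sub_eq (Φ := fun W =>
    sandwich (h.toBlocks₁₁ - of (moebius h Z) * h.toBlocks₂₁) (denom h W)⁻¹) ?_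
    (Filter.mem_of_superset hnhds fun W hW => hh.moebius_sub_moebius hZ hW)
  refine (continuousOn_clm_apply.2 fun X => ?_).continuousAt hnhds
  exact (continuous_const.matrix_mul continuous_id).comp_continuousOn hh.continuousOn_inv_denom

lemma differentiableOn_moebius : DifferentiableOn ℂ (moebius h) domainD := fun _ hZ =>
  (hh.hasFDerivAt_moebius hZ).differentiableAt.differentiableWithinAt

lemma det_sub_moebius (hdet : h.det = 1) (hZ : Z ∈ domainD) :
    (h.toBlocks₁₁ - of (moebius h Z) * h.toBlocks₂₁).det = (autFactor h Z)⁻¹ := by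
  let := ((isUnit_iff_isUnit_det _).2 (hh.isUnit_det_denom hZ)).invertible
  have hblocks := congrArg det (mul_fromBlocks_one h Z)
  rw [det_mul, hdet, det_fromBlocks_zero₂₁, det_fromBlocks₂₂, det_one, invOf_eq_nonsing_inv,
    ← of_moebius, one_mul, one_mul, ← autFactor_eq, mul_comm] at hblocks
  exact eq_inv_of_mul_eq_one_left hblocks.symm

lemma abs_det_moebiusDeriv (hdet : h.det = 1) (hZ : Z ∈ domainD) :
    |((moebiusDeriv h Z).restrictScalars ℝ).det| = (‖autFactor h Z‖ ^ 8)⁻¹ := by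
  have hreal : ((moebiusDeriv h Z).restrictScalars ℝ).det =
      LinearMap.det ((moebiusDeriv h Z : Mat2 →ₗ[ℂ] Mat2).restrictScalars ℝ) := rfl
  rw [hreal, LinearMap.det_restrictScalars, moebiusDeriv, det_sandwich,
    hh.det_sub_moebius hdet hZ, det_nonsing_inv, Ring.inverse_eq_inv', ← autFactor_eq,
    Algebra.norm_complex_apply, Complex.normSq_eq_norm_sq, abs_of_nonneg (by positivity), norm_mul,
    norm_pow, norm_inv]
  ring

end IsTwistorUnitary

end MoebiusDerivative

section Domain

open Matrix

lemma zero_mem_domainD : (0 : Mat2) ∈ domainD := by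
  change (1 - (0 : Matrix (Fin 2) (Fin 2) ℂ)ᴴ * 0).PosDef
  simpa using PosDef.one

lemma norm_apply_lt_one {Z : Mat2} (hZ : Z ∈ domainD) (k l : Fin 2) : ‖Z k l‖ < 1 := by
  have hdiag : 0 < 1 - ∑ i, ‖Z i l‖ ^ 2 := by
    have hpos := (Complex.pos_iff.1 (PosDef.diag_pos (i := l) hZ)).1
    simpa only [Matrix.sub_apply, Matrix.mul_apply, conjTranspose_apply, of_apply, one_apply_eq,
      Complex.star_def, Complex.conj_mul', Complex.sub_re, Complex.re_sum, Complex.one_re,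
      ← Complex.ofReal_pow, Complex.ofReal_re] using hpos
  have hle : ‖Z k l‖ ^ 2 ≤ ∑ i, ‖Z i l‖ ^ 2 :=
    Finset.single_le_sum (f := fun i => ‖Z i l‖ ^ 2) (fun i _ => sq_nonneg _) (Finset.mem_univ k)
  exact (sq_lt_one_iff₀ (norm_nonneg _)).1 (by linarith)

lemma domainD_subset_closedBall : domainD ⊆ closedBall (0 : Mat2) 1 := fun Z hZ => by
  rw [mem_closedBall_zero_iff, pi_norm_le_iff_of_nonneg zero_le_one]
  exact fun k => (pi_norm_le_iff_of_nonneg zero_le_one).2 fun l => (norm_apply_lt_one hZ k l).le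

lemma smul_mem_domainD {Z : Mat2} (hZ : Z ∈ domainD) {t : ℂ} (ht : ‖t‖ ≤ 1) :
    t • Z ∈ domainD := by
  have hconvex : 1 - (of (t • Z))ᴴ * of (t • Z) =
      ((1 - ‖t‖ ^ 2 : ℝ) : ℂ) • (1 : Matrix (Fin 2) (Fin 2) ℂ) +
        ((‖t‖ ^ 2 : ℝ) : ℂ) • (1 - (of Z)ᴴ * of Z) := by
    rw [← smul_of, conjTranspose_smul, smul_mul_smul_comm, Complex.star_def, Complex.conj_mul',
      smul_sub]
    push_cast
    module
  rcases eq_or_ne t 0 with rfl | ht0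
  · simpa using zero_mem_domainD
  change PosDef _
  rw [hconvex]
  refine PosDef.posSemidef_add (PosSemidef.one.smul ?_) (PosDef.smul hZ ?_)
  · exact_mod_cast sub_nonneg.2 (pow_le_one₀ (norm_nonneg t) ht)
  · exact_mod_cast pow_pos (norm_pos_iff.2 ht0) 2

lemma detKernel_eq (W Z : Mat2) : detKernel W Z =
    1 - ∑ k, ∑ l, star (W k l) * Z k l + star (of W).det * (of Z).det := by
  simp only [detKernel, det_fin_two, Fin.sum_univ_two, Matrix.sub_apply, Matrix.mul_apply,
    conjTranspose_apply, of_apply, one_apply_eq, one_apply_ne zero_ne_one, one_apply_ne one_ne_zero,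
    star_sub, star_mul']
  ring

lemma detKernel_zero_left (Z : Mat2) : detKernel 0 Z = 1 := by simp [detKernel]

/-- The diagonal matrix `diag (t, s)` as a point of `Mat2`. -/
def diagPoint (t s : ℂ) : Mat2 := ![![t, 0], ![0, s]]

lemma one_sub_diagPoint (t s t' s' : ℂ) :
    1 - (of (diagPoint t s))ᴴ * of (diagPoint t' s') =
      diagonal ![1 - star t * t', 1 - star s * s'] := by
  ext i j
  fin_cases i <;> fin_cases j <;> simp [diagPoint, Matrix.mul_apply, Fin.sum_univ_two]

lemma diagPoint_mem {t s : ℂ} (ht : ‖t‖ < 1) (hs : ‖s‖ < 1) : diagPoint t s ∈ domainD := by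
  have hpos : ∀ z : ℂ, ‖z‖ < 1 → 0 < 1 - star z * z := fun z hz => by
    rw [Complex.star_def, Complex.conj_mul']
    exact_mod_cast sub_pos.2 (pow_lt_one₀ (norm_nonneg z) hz two_ne_zero)
  change PosDef _
  rw [one_sub_diagPoint]
  exact PosDef.diagonal (Fin.forall_fin_two.2 ⟨hpos t ht, hpos s hs⟩)

lemma detKernel_diagPoint (t s t' s' : ℂ) :
    detKernel (diagPoint t s) (diagPoint t' s') = (1 - star t * t') * (1 - star s * s') := by
  rw [detKernel, one_sub_diagPoint, det_diagonal]
  simp [Fin.prod_univ_two]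

end Domain

section Transitivity

open Matrix

lemma det_twistorForm : twistorForm.det = 1 := by
  rw [twistorForm, det_fromBlocks_zero₂₁, det_neg]
  simp

lemma IsTwistorUnitary.norm_det {h : Mat22} (hh : IsTwistorUnitary h) : ‖h.det‖ = 1 := by
  have hdet := congrArg det hh
  rw [det_mul, det_mul, det_conjTranspose, det_twistorForm, mul_one, Complex.star_def,
    Complex.conj_mul'] at hdet
  exact (pow_eq_one_iff_of_nonneg (norm_nonneg _) two_ne_zero).1 (by exact_mod_cast hdet)

lemma IsTwistorUnitary.exists_SU22_eq_smul {h : Mat22} (hh : IsTwistorUnitary h) :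
    ∃ (g : SU22) (u : ℂ), g.1.1 = u • h := by
  have hne : h.det ≠ 0 := norm_ne_zero_iff.1 (hh.norm_det ▸ one_ne_zero)
  obtain ⟨u, hu⟩ := IsAlgClosed.exists_pow_nat_eq h.det⁻¹ four_pos
  have hnorm : ‖u‖ = 1 := by
    refine (pow_eq_one_iff_of_nonneg (norm_nonneg _) four_ne_zero).1 ?_
    rw [← norm_pow, hu, norm_inv, hh.norm_det, inv_one]
  have hdet : (u • h).det = 1 := by simp [hu, hne]
  have hform : IsTwistorUnitary (u • h) := by
    rw [IsTwistorUnitary, conjTranspose_smul, smul_mul, smul_mul_smul_comm, hh, Complex.star_def,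
      Complex.conj_mul', hnorm]
    simp
  exact ⟨⟨⟨u • h, hdet⟩, hform⟩, u, rfl⟩

open scoped MatrixOrder in
lemma exists_conjTranspose_mul_self_eq {P : Matrix (Fin 2) (Fin 2) ℂ} (hP : P.PosDef) :
    ∃ A, Aᴴ * A = P :=
  (CStarAlgebra.nonneg_iff_eq_star_mul_self.1 hP.posSemidef.nonneg).imp fun _ => Eq.symm

lemma exists_isTwistorUnitary_numer_eq_zero {W : Mat2} (hW : W ∈ domainD) :
    ∃ h, IsTwistorUnitary h ∧ numer h W = 0 := by
  set w : Matrix (Fin 2) (Fin 2) ℂ := of W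
  have hP : (1 - wᴴ * w).PosDef := hW
  set R := (1 - wᴴ * w)⁻¹
  have hunit : IsUnit (1 - wᴴ * w).det := (isUnit_iff_isUnit_det _).1 hP.isUnit
  have hR : R * (wᴴ * w) = R - 1 := by
    rw [← nonsing_inv_mul _ hunit, Matrix.mul_sub, Matrix.mul_one, sub_sub_cancel]
  have hR' : (wᴴ * w) * R = R - 1 := by
    rw [← mul_nonsing_inv _ hunit, Matrix.sub_mul, Matrix.one_mul, sub_sub_cancel]
  obtain ⟨D, hD⟩ := exists_conjTranspose_mul_self_eq hP.inv
  obtain ⟨A, hA⟩ := exists_conjTranspose_mul_self_eq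
    (PosDef.one.add_posSemidef (hP.inv.posSemidef.mul_mul_conjTranspose_same w))
  refine ⟨fromBlocks A (-(A * w)) (-(D * wᴴ)) D, isTwistorUnitary_fromBlocks_iff.2 ?_, ?_⟩
  · simp only [conjTranspose_neg, conjTranspose_mul, conjTranspose_conjTranspose]
    refine ⟨?_, ?_, ?_, ?_⟩
    · calc _ = Aᴴ * A - w * (Dᴴ * D) * wᴴ := by noncomm_ring
        _ = 1 := by rw [hA, hD]; noncomm_ring
    · calc _ = -(Aᴴ * A) * w + w * (Dᴴ * D) := by noncomm_ring
        _ = -w - w * (R * (wᴴ * w)) + w * R := by rw [hA, hD]; noncomm_ring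
        _ = 0 := by rw [hR]; noncomm_ring
    · calc _ = -wᴴ * (Aᴴ * A) + (Dᴴ * D) * wᴴ := by noncomm_ring
        _ = -wᴴ - ((wᴴ * w) * R) * wᴴ + R * wᴴ := by rw [hA, hD]; noncomm_ring
        _ = 0 := by rw [hR']; noncomm_ring
    · calc _ = wᴴ * (Aᴴ * A) * w - Dᴴ * D := by noncomm_ring
        _ = wᴴ * w + ((wᴴ * w) * R) * (wᴴ * w) - R := by rw [hA, hD]; noncomm_ring
        _ = R * (wᴴ * w) - R := by rw [hR']; noncomm_ring
        _ = -1 := by rw [hR]; noncomm_ring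
  · rw [numer, toBlocks_fromBlocks₁₁, toBlocks_fromBlocks₁₂, add_neg_cancel]

lemma exists_moebius_eq_zero {W : Mat2} (hW : W ∈ domainD) :
    ∃ g : SU22, moebius g.1.1 W = 0 := by
  obtain ⟨h, hh, hnumer⟩ := exists_isTwistorUnitary_numer_eq_zero hW
  obtain ⟨g, u, hg⟩ := hh.exists_SU22_eq_smul
  have hsmul : numer (u • h) W = u • numer h W := by
    change (u • h.toBlocks₁₁) * of W + u • h.toBlocks₁₂ = _
    rw [Matrix.smul_mul, ← smul_add, numer]
  refine ⟨g, of.injective ?_⟩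
  rw [hg, of_moebius, hsmul, hnumer, smul_zero, Matrix.zero_mul, of_zero]

/-- The element `diag (u, u, ū, ū)` of `SU(2,2)`, which acts on `𝔻` as `Z ↦ u² Z`. -/
def rotation (u : Circle) : SU22 :=
  ⟨⟨fromBlocks ((u : ℂ) • 1) 0 0 (star (u : ℂ) • 1), by
    rw [det_fromBlocks_zero₂₁, det_smul, det_smul, det_one, Fintype.card_fin, mul_one, mul_one,
      ← mul_pow, Complex.star_def, Complex.mul_conj', Circle.norm_coe]
    simp⟩, by
    refine isTwistorUnitary_fromBlocks_iff.2 ?_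
    simp [smul_smul, Complex.mul_conj', Complex.conj_mul', Circle.norm_coe]⟩

lemma numer_rotation (u : Circle) (Z : Mat2) : numer (rotation u).1.1 Z = (u : ℂ) • of Z := by
  change numer (fromBlocks _ _ _ _) Z = _
  simp [numer]

lemma denom_rotation (u : Circle) (Z : Mat2) : denom (rotation u).1.1 Z = star (u : ℂ) • 1 := by
  change denom (fromBlocks _ _ _ _) Z = _
  simp [denom]

lemma autFactor_rotation (u : Circle) (Z : Mat2) :
    autFactor (rotation u).1.1 Z = star (u : ℂ) ^ 2 := by
  rw [autFactor_eq, denom_rotation]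
  simp

lemma moebius_rotation (u : Circle) (Z : Mat2) :
    moebius (rotation u).1.1 Z = ((u : ℂ) ^ 2) • Z := by
  have hinv : (star (u : ℂ) • (1 : Matrix (Fin 2) (Fin 2) ℂ))⁻¹ = (u : ℂ) • 1 :=
    inv_eq_right_inv (by simp [smul_smul, Complex.mul_conj', Circle.norm_coe])
  refine of.injective ?_
  rw [of_moebius, numer_rotation, denom_rotation, hinv, smul_mul_smul_comm, Matrix.mul_one, ← sq,
    smul_of]

end Transitivity

section BergmanMeasure

lemma lintegral_bergmanMeasure (lam : ℕ) (F : Mat2 → ℝ≥0∞) :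
    ∫⁻ Z, F Z ∂(bergmanMeasure lam) =
      ∫⁻ Z in domainD, ENNReal.ofReal (cConst lam * weight Z ^ (lam - 4)) * F Z := by
  have hmeas : Measurable fun Z => ENNReal.ofReal (cConst lam * weight Z ^ (lam - 4)) :=
    (continuous_const.mul (continuous_weight.pow _)).measurable.ennreal_ofReal
  exact lintegral_withDensity_eq_lintegral_mul_non_measurable _ hmeas
    (Eventually.of_forall fun _ => ENNReal.ofReal_lt_top) F

lemma ae_mem_domainD (lam : ℕ) : ∀ᵐ Z ∂(bergmanMeasure lam), Z ∈ domainD :=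
  (withDensity_absolutelyContinuous _ _).ae_le (ae_restrict_mem isOpen_domainD.measurableSet)

lemma aestronglyMeasurable_bergmanMeasure (lam : ℕ) {f : Mat2 → ℂ}
    (hf : DifferentiableOn ℂ f domainD) : AEStronglyMeasurable f (bergmanMeasure lam) :=
  (hf.continuousOn.aestronglyMeasurable isOpen_domainD.measurableSet).mono_ac
    (withDensity_absolutelyContinuous _ _)

instance isFiniteMeasure_bergmanMeasure (lam : ℕ) : IsFiniteMeasure (bergmanMeasure lam) := by
  have hint : IntegrableOn (fun Z : Mat2 => cConst lam * weight Z ^ (lam - 4)) domainD :=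
    ((continuous_const.mul (continuous_weight.pow _)).continuousOn.integrableOn_compact
      (isCompact_closedBall 0 1)).mono_set domainD_subset_closedBall
  refine ⟨?_⟩
  rw [← lintegral_one, lintegral_bergmanMeasure]
  simp only [mul_one]
  exact lt_of_le_of_lt (lintegral_mono fun Z => Real.ofReal_le_enorm _) hint.2

instance isAddHaarMeasure_volume_mat2 : (volume : Measure Mat2).IsAddHaarMeasure :=
  Measure.pi.isAddHaarMeasure fun _ : Fin 2 => (volume : Measure (Fin 2 → ℂ))

lemma moebius_inv_moebius (g : SU22) {Z : Mat2} (hZ : Z ∈ domainD) :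
    moebius (g⁻¹ : SU22).1.1 (moebius g.1.1 Z) = Z := by
  have hmul : (g⁻¹ : SU22).1.1 * g.1.1 = 1 := congrArg (fun g : SU22 => g.1.1) (inv_mul_cancel g)
  rw [← (isTwistorUnitary_coe g).moebius_mul hZ, hmul, moebius_one]

lemma bijOn_moebius (g : SU22) : Set.BijOn (moebius g.1.1) domainD domainD :=
  Set.InvOn.bijOn
    ⟨fun _ hZ => moebius_inv_moebius g hZ,
      fun Z hZ => by simpa only [inv_inv] using moebius_inv_moebius g⁻¹ hZ⟩
    (fun _ => (isTwistorUnitary_coe g).moebius_mem)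
    fun _ => (isTwistorUnitary_coe g⁻¹).moebius_mem

lemma lintegral_comp_moebius (lam : ℕ) [Fact (3 < lam)] (g : SU22) (F : Mat2 → ℝ≥0∞) :
    ∫⁻ Z, ENNReal.ofReal ((‖autFactor g.1.1 Z‖ ^ (2 * lam))⁻¹) * F (moebius g.1.1 Z)
      ∂(bergmanMeasure lam) = ∫⁻ Z, F Z ∂(bergmanMeasure lam) := by
  have hg := isTwistorUnitary_coe g
  rw [lintegral_bergmanMeasure, lintegral_bergmanMeasure]
  conv_rhs => rw [← (bijOn_moebius g).image_eq]
  rw [lintegral_image_eq_lintegral_abs_det_fderiv_mul volume isOpen_domainD.measurableSet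
    (fun Z hZ => ((hg.hasFDerivAt_moebius hZ).restrictScalars ℝ).hasFDerivWithinAt)
    (bijOn_moebius g).injOn]
  refine setLIntegral_congr_fun isOpen_domainD.measurableSet fun Z hZ => ?_
  have hc := cConst_pos lam
  have hweight := weight_pos hZ
  rw [hg.abs_det_moebiusDeriv g.1.2 hZ, ← mul_assoc, ← mul_assoc,
    ← ENNReal.ofReal_mul (by positivity), ← ENNReal.ofReal_mul (by positivity)]
  congr 2
  have hne : ‖autFactor g.1.1 Z‖ ≠ 0 := norm_ne_zero_iff.2 (hg.autFactor_ne_zero hZ)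
  have hexp : 2 * lam = 2 * (lam - 4) + 8 := by have : 3 < lam := Fact.out; omega
  rw [← hg.weight_moebius hZ, mul_pow, ← pow_mul, hexp, pow_add]
  field_simp

lemma eLpNorm_two_bergmanMeasure (lam : ℕ) (f : Mat2 → ℂ) :
    eLpNorm f 2 (bergmanMeasure lam) =
      (∫⁻ W, ‖f W‖ₑ ^ 2 ∂(bergmanMeasure lam)) ^ (1 / 2 : ℝ) := by
  rw [eLpNorm_eq_lintegral_rpow_enorm_toReal two_ne_zero ENNReal.ofNat_ne_top]
  simp only [ENNReal.toReal_ofNat, ENNReal.rpow_ofNat]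

/-- The transform `f ↦ det(CZ + D)^(-λ) f((AZ + B)(CZ + D)⁻¹)` of functions on `𝔻` which defines
the discrete series. -/
def weightedComp (lam : ℕ) (h : Mat22) (f : Mat2 → ℂ) : Mat2 → ℂ := fun Z =>
  (autFactor h Z ^ lam)⁻¹ * f (moebius h Z)

lemma eLpNorm_weightedComp (lam : ℕ) [Fact (3 < lam)] (g : SU22) (f : Mat2 → ℂ) :
    eLpNorm (weightedComp lam g.1.1 f) 2 (bergmanMeasure lam) =
      eLpNorm f 2 (bergmanMeasure lam) := by
  rw [eLpNorm_two_bergmanMeasure, eLpNorm_two_bergmanMeasure,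
    ← lintegral_comp_moebius lam g fun W => ‖f W‖ₑ ^ 2]
  congr 2
  funext Z
  rw [weightedComp, enorm_mul, mul_pow, ← ofReal_norm, ← ENNReal.ofReal_pow (norm_nonneg _),
    norm_inv, norm_pow, inv_pow, ← pow_mul, mul_comm lam]

lemma differentiableOn_weightedComp (lam : ℕ) (g : SU22) {f : Mat2 → ℂ}
    (hf : DifferentiableOn ℂ f domainD) :
    DifferentiableOn ℂ (weightedComp lam g.1.1 f) domainD := by
  have hg := isTwistorUnitary_coe g
  exact (((differentiable_autFactor _).pow _).differentiableOn.inv fun Z hZ =>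
    pow_ne_zero _ (hg.autFactor_ne_zero hZ)).mul
      (hf.comp hg.differentiableOn_moebius fun Z => hg.moebius_mem)

end BergmanMeasure

section BergmanSpace

/-- The element of `L²𝒪(𝔻, dμ_λ)` given by a square integrable holomorphic function. -/
def bergmanMk (lam : ℕ) (f : Mat2 → ℂ) (hf : DifferentiableOn ℂ f domainD)
    (hm : MemLp f 2 (bergmanMeasure lam)) : bergmanSpace lam :=
  ⟨hm.toLp, f, hf, hm.coeFn_toLp⟩

lemma ext_holFun {lam : ℕ} {ψ φ : bergmanSpace lam}
    (h : ∀ Z ∈ domainD, holFun ψ Z = holFun φ Z) : ψ = φ := by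
  refine Subtype.ext (Lp.ext ?_)
  filter_upwards [ae_eq_holFun ψ, ae_eq_holFun φ, ae_mem_domainD lam] with Z hψ hφ hZ
  rw [hψ, hφ, h Z hZ]

variable {lam : ℕ} [Fact (3 < lam)]

lemma holFun_bergmanMk {f : Mat2 → ℂ} (hf : DifferentiableOn ℂ f domainD)
    (hm : MemLp f 2 (bergmanMeasure lam)) {Z : Mat2} (hZ : Z ∈ domainD) :
    holFun (bergmanMk lam f hf hm) Z = f Z := by
  have hae : (bergmanMk lam f hf hm : Lp ℂ 2 (bergmanMeasure lam)) =ᵐ[bergmanMeasure lam] f :=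
    hm.coeFn_toLp
  exact eqOn_of_ae_eq lam (differentiableOn_holFun _) hf ((ae_eq_holFun _).symm.trans hae) hZ

lemma memLp_weightedComp (g : SU22) (ψ : bergmanSpace lam) :
    MemLp (weightedComp lam g.1.1 (holFun ψ)) 2 (bergmanMeasure lam) := by
  refine ⟨aestronglyMeasurable_bergmanMeasure lam
    (differentiableOn_weightedComp lam g (differentiableOn_holFun ψ)), ?_⟩
  rw [eLpNorm_weightedComp, ← eLpNorm_congr_ae (ae_eq_holFun ψ)]
  exact (Lp.memLp _).2

end BergmanSpace

section Representation

variable {lam : ℕ} [Fact (3 < lam)] {H : Type*} [NormedAddCommGroup H] [InnerProductSpace ℂ H]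
  (I : H ≃ₗᵢ⋆[ℂ] bergmanSpace lam)

/-- The operator `U_λ(g)` of the discrete series, as a bare map. -/
def discreteSeriesFun (g : SU22) (x : H) : H :=
  I.symm (bergmanMk lam _ (differentiableOn_weightedComp lam g⁻¹ (differentiableOn_holFun (I x)))
    (memLp_weightedComp g⁻¹ (I x)))

lemma holFun_discreteSeriesFun (g : SU22) (x : H) {Z : Mat2} (hZ : Z ∈ domainD) :
    holFun (I (discreteSeriesFun I g x)) Z =
      weightedComp lam (g⁻¹ : SU22).1.1 (holFun (I x)) Z := by
  rw [discreteSeriesFun, I.apply_symm_apply, holFun_bergmanMk _ _ hZ]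

lemma norm_discreteSeriesFun (g : SU22) (x : H) : ‖discreteSeriesFun I g x‖ = ‖x‖ := by
  rw [discreteSeriesFun, I.symm.norm_map, ← I.norm_map x, Submodule.coe_norm, Submodule.coe_norm,
    bergmanMk, Lp.norm_toLp, eLpNorm_weightedComp, ← eLpNorm_congr_ae (ae_eq_holFun (I x)),
    ← Lp.norm_def]

lemma discreteSeriesFun_mul (g₁ g₂ : SU22) (x : H) :
    discreteSeriesFun I (g₁ * g₂) x = discreteSeriesFun I g₁ (discreteSeriesFun I g₂ x) := by
  refine I.injective (ext_holFun fun Z hZ => ?_)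
  have hg := isTwistorUnitary_coe g₁⁻¹
  have hmul : ((g₁ * g₂)⁻¹ : SU22).1.1 = (g₂⁻¹ : SU22).1.1 * (g₁⁻¹ : SU22).1.1 :=
    congrArg (fun g : SU22 => g.1.1) (mul_inv_rev g₁ g₂)
  rw [holFun_discreteSeriesFun I _ _ hZ, holFun_discreteSeriesFun I _ _ hZ, weightedComp,
    weightedComp, holFun_discreteSeriesFun I _ _ (hg.moebius_mem hZ), weightedComp, hmul,
    hg.moebius_mul hZ, hg.autFactor_mul hZ, mul_pow, mul_inv]
  ring

lemma discreteSeriesFun_one (x : H) : discreteSeriesFun I 1 x = x := by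
  refine I.injective (ext_holFun fun Z hZ => ?_)
  have hone : ((1 : SU22)⁻¹ : SU22).1.1 = 1 := congrArg (fun g : SU22 => g.1.1) inv_one
  rw [holFun_discreteSeriesFun I _ _ hZ, weightedComp, hone, moebius_one, autFactor_one, one_pow,
    inv_one, one_mul]

/-- The operator `U_λ(g)` of the discrete series, as a linear isometric equivalence. -/
def discreteSeriesEquiv (g : SU22) : H ≃ₗᵢ[ℂ] H where
  toFun := discreteSeriesFun I g
  invFun := discreteSeriesFun I g⁻¹
  left_inv x := by rw [← discreteSeriesFun_mul, inv_mul_cancel, discreteSeriesFun_one]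
  right_inv x := by rw [← discreteSeriesFun_mul, mul_inv_cancel, discreteSeriesFun_one]
  map_add' x y := I.injective <| ext_holFun fun Z hZ => by
    rw [map_add, holFun_add _ _ hZ]
    simp only [holFun_discreteSeriesFun I _ _ hZ, weightedComp, map_add,
      holFun_add _ _ ((isTwistorUnitary_coe g⁻¹).moebius_mem hZ), mul_add]
  map_smul' c x := I.injective <| ext_holFun fun Z hZ => by
    rw [map_smulₛₗ, holFun_smul _ _ hZ]
    simp only [holFun_discreteSeriesFun I _ _ hZ, weightedComp, map_smulₛₗ, RingHom.id_apply,
      holFun_smul _ _ ((isTwistorUnitary_coe g⁻¹).moebius_mem hZ)]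
    ring
  norm_map' x := norm_discreteSeriesFun I g x

variable [CompleteSpace H]

/-- The discrete series representation `U_λ` of `SU(2,2)` on `ℋ`. -/
def discreteSeries : SU22 →* unitary (H →L[ℂ] H) :=
  (Unitary.linearIsometryEquiv (𝕜 := ℂ) (H := H)).symm.toMonoidHom.comp
    { toFun := discreteSeriesEquiv I
      map_one' := LinearIsometryEquiv.ext (discreteSeriesFun_one I)
      map_mul' := fun g₁ g₂ => LinearIsometryEquiv.ext (discreteSeriesFun_mul I g₁ g₂) }

lemma isDiscreteSeries_discreteSeries : IsDiscreteSeries I (discreteSeries I) :=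
  fun g ψ _ hZ => holFun_discreteSeriesFun I g ψ hZ

end Representation

section Symbol

variable {𝕜 E ι : Type*} [NontriviallyNormedField 𝕜] [NormedAddCommGroup E] [NormedSpace 𝕜 E]
  {v : ι → E} {S T : E →L[𝕜] E} {f g : ι → 𝕜}

/-- The operator `T` is diagonal on the family `v`, with eigenvalue `f i` at `v i`. When `v` is the
family of coherent states this says `T = a(f)`. -/
def HasSymbol (v : ι → E) (T : E →L[𝕜] E) (f : ι → 𝕜) : Prop := ∀ i, T (v i) = f i • v i

lemma HasSymbol.unique (hv : Dense (Submodule.span 𝕜 (Set.range v) : Set E))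
    (hS : HasSymbol v S f) (hT : HasSymbol v T f) : S = T :=
  ContinuousLinearMap.ext_on hv <| by
    rintro _ ⟨i, rfl⟩
    rw [hS, hT]

lemma hasSymbol_algebraMap (v : ι → E) (c : 𝕜) :
    HasSymbol v (algebraMap 𝕜 (E →L[𝕜] E) c) (algebraMap 𝕜 (ι → 𝕜) c) := fun _ => rfl

lemma HasSymbol.mul (hS : HasSymbol v S f) (hT : HasSymbol v T g) :
    HasSymbol v (S * T) (f * g) := fun i => by
  rw [mul_apply_eq_comp, hT, map_smul, hS, smul_smul, mul_comm, Pi.mul_apply]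

lemma HasSymbol.add (hS : HasSymbol v S f) (hT : HasSymbol v T g) :
    HasSymbol v (S + T) (f + g) := fun i => by
  rw [_root_.add_apply, hS, hT, Pi.add_apply, add_smul]

/-- The algebra of the symbols of the operators in `A`. -/
def symbolAlgebra (v : ι → E) (A : Subalgebra 𝕜 (E →L[𝕜] E)) : Subalgebra 𝕜 (ι → 𝕜) where
  carrier := {f | ∃ T ∈ A, HasSymbol v T f}
  mul_mem' := by
    rintro f g ⟨S, hS, hf⟩ ⟨T, hT, hg⟩
    exact ⟨S * T, mul_mem hS hT, hf.mul hg⟩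
  add_mem' := by
    rintro f g ⟨S, hS, hf⟩ ⟨T, hT, hg⟩
    exact ⟨S + T, add_mem hS hT, hf.add hg⟩
  algebraMap_mem' c := ⟨_, A.algebraMap_mem c, hasSymbol_algebraMap v c⟩

/-- The algebra of the operators for which every `v i` is an eigenvector. -/
def eigenAlgebra (v : ι → E) : Subalgebra 𝕜 (E →L[𝕜] E) where
  carrier := {T | ∃ f, HasSymbol v T f}
  mul_mem' := fun ⟨_, hS⟩ ⟨_, hT⟩ => ⟨_, hS.mul hT⟩
  add_mem' := fun ⟨_, hS⟩ ⟨_, hT⟩ => ⟨_, hS.add hT⟩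
  algebraMap_mem' c := ⟨_, hasSymbol_algebraMap v c⟩

lemma isClosed_eigenAlgebra [CompleteSpace 𝕜] (v : ι → E) :
    IsClosed (eigenAlgebra (𝕜 := 𝕜) v : Set (E →L[𝕜] E)) := by
  have hspan : (eigenAlgebra (𝕜 := 𝕜) v : Set (E →L[𝕜] E)) =
      ⋂ i, {T | T (v i) ∈ Submodule.span 𝕜 {v i}} := by
    ext T
    simp only [Set.mem_iInter, Submodule.mem_span_singleton]
    exact ⟨fun ⟨f, hf⟩ i => ⟨f i, (hf i).symm⟩, fun h => ⟨fun i => (h i).choose,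
      fun i => (h i).choose_spec.symm⟩⟩
  rw [hspan]
  exact isClosed_iInter fun i =>
    (Submodule.closed_of_finiteDimensional (Submodule.span 𝕜 {v i})).preimage (by fun_prop)

end Symbol

section SymbolHilbert

variable {H ι : Type*} [NormedAddCommGroup H] [InnerProductSpace ℂ H] [CompleteSpace H] {v : ι → H}

lemma HasSymbol.inner_star_mul_mul {S T : H →L[ℂ] H} {f g : ι → ℂ} (hS : HasSymbol v S f)
    (hT : HasSymbol v T g) (X : H →L[ℂ] H) (i j : ι) :
    ⟪v i, (star S * X * T) (v j)⟫_ℂ = star (f i) * g j * ⟪v i, X (v j)⟫_ℂ := by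
  rw [mul_apply_eq_comp, mul_apply_eq_comp,
    ContinuousLinearMap.star_eq_adjoint, ContinuousLinearMap.adjoint_inner_right, hS, hT, map_smul,
    inner_smul_left, inner_smul_right, Complex.star_def, mul_assoc]

lemma inv_mem_symbolAlgebra (hv : Dense (Submodule.span ℂ (Set.range v) : Set H))
    {M : StarSubalgebra ℂ (H →L[ℂ] H)} (hM : IsClosed (M : Set (H →L[ℂ] H))) {f : ι → ℂ}
    (hf : f ∈ symbolAlgebra v M.toSubalgebra) (hf0 : ∀ i, f i ≠ 0) {S : H →L[ℂ] H}
    (hS : HasSymbol v S f⁻¹) : f⁻¹ ∈ symbolAlgebra v M.toSubalgebra := by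
  obtain ⟨T, hTM, hT⟩ := hf
  have hone : HasSymbol v (1 : H →L[ℂ] H) 1 := by simpa using hasSymbol_algebraMap v (1 : ℂ)
  have hinv : f⁻¹ * f = 1 := funext fun i => inv_mul_cancel₀ (hf0 i)
  have hST : S * T = 1 := (hinv ▸ hS.mul hT).unique hv hone
  have hTS : T * S = 1 := ((mul_comm f⁻¹ f ▸ hinv) ▸ hT.mul hS).unique hv hone
  obtain ⟨R, hR⟩ : ∃ R, (⟨T, hTM⟩ : M) * R = 1 :=
    ((StarSubalgebra.coe_isUnit M).1 ⟨⟨T, S, hTS, hST⟩, rfl⟩).exists_right_inv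
  have hSR : S = R := left_inv_eq_right_inv hST (congrArg Subtype.val hR)
  exact ⟨S, hSR ▸ R.2, hS⟩

end SymbolHilbert

section CoherentStates

variable {lam : ℕ} [Fact (3 < lam)] {H : Type*} [NormedAddCommGroup H] [InnerProductSpace ℂ H]
  (I : H ≃ₗᵢ⋆[ℂ] bergmanSpace lam)

/-- The vector of `ℋ` corresponding to the constant function `1`. -/
def constState : H :=
  I.symm (bergmanMk lam (fun _ => 1) (differentiableOn_const 1) (memLp_const 1))

lemma inner_constState (Z : domainD) : ⟪constState I, coherentState I Z⟫_ℂ = 1 := by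
  rw [inner_coherentState, constState, I.apply_symm_apply, holFun_bergmanMk _ _ Z.2]

lemma coherentState_ne_zero (Z : domainD) : coherentState I Z ≠ 0 := fun h => by
  simpa [h] using inner_constState I Z

/-- The origin, as a point of `𝔻`. -/
def originD : domainD := ⟨0, zero_mem_domainD⟩

/-- The action of `SU(2,2)` on `𝔻`. -/
def actD (g : SU22) (Z : domainD) : domainD :=
  ⟨moebius g.1.1 Z, (isTwistorUnitary_coe g).moebius_mem Z.2⟩

lemma exists_actD_eq_originD (Z : domainD) : ∃ g : SU22, actD g Z = originD :=
  (exists_moebius_eq_zero Z.2).imp fun _ => Subtype.ext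

lemma detKernel_eq_autFactor {g : SU22} {W : domainD} (hg : actD g W = originD) (Z : domainD) :
    detKernel W Z = star (autFactor g.1.1 W) * autFactor g.1.1 Z := by
  rw [← (isTwistorUnitary_coe g).detKernel_moebius Z.2 W.2,
    show moebius g.1.1 W = 0 from congrArg Subtype.val hg, detKernel_zero_left, mul_one]

lemma actD_inv_actD (g : SU22) (Z : domainD) : actD g⁻¹ (actD g Z) = Z :=
  Subtype.ext (moebius_inv_moebius g Z.2)

/-- The squared norm of the coherent state at the origin. -/
def vacuumNormSq : ℂ := ⟪coherentState I originD, coherentState I originD⟫_ℂ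

lemma vacuumNormSq_ne_zero : vacuumNormSq I ≠ 0 :=
  inner_self_ne_zero.2 (coherentState_ne_zero I _)

variable [CompleteSpace H]

lemma dense_span_coherentState :
    Dense (Submodule.span ℂ (Set.range (coherentState I)) : Set H) :=
  dense_span_of_forall_inner_eq_zero fun x hx => I.injective <| ext_holFun fun Z hZ => by
    rw [← inner_coherentState I x ⟨Z, hZ⟩, ← inner_coherentState I 0 ⟨Z, hZ⟩, hx, inner_zero_left]

lemma adjoint_discreteSeries (g : SU22) :
    ContinuousLinearMap.adjoint (discreteSeries I g : H →L[ℂ] H) = discreteSeries I g⁻¹ := by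
  rw [map_inv]
  rfl

lemma discreteSeries_coherentState (g : SU22) (Z : domainD) :
    (discreteSeries I g : H →L[ℂ] H) (coherentState I Z) =
      ((autFactor g.1.1 Z) ^ lam)⁻¹ • coherentState I (actD g Z) := by
  refine ext_inner_left ℂ fun ψ => ?_
  rw [← inv_inv g, ← adjoint_discreteSeries, ContinuousLinearMap.adjoint_inner_right,
    inner_smul_right, inner_coherentState, inner_coherentState,
    isDiscreteSeries_discreteSeries I g⁻¹ ψ Z Z.2]
  rfl

lemma inner_coherentState_actD (g : SU22) (W Z : domainD) :
    ⟪coherentState I (actD g W), coherentState I (actD g Z)⟫_ℂ =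
      (star (autFactor g.1.1 W) * autFactor g.1.1 Z) ^ lam *
        ⟪coherentState I W, coherentState I Z⟫_ℂ := by
  have hW := (isTwistorUnitary_coe g).autFactor_ne_zero W.2
  have hZ := (isTwistorUnitary_coe g).autFactor_ne_zero Z.2
  rw [← Unitary.inner_map_map (discreteSeries I g) (coherentState I W),
    discreteSeries_coherentState, discreteSeries_coherentState, inner_smul_left, inner_smul_right,
    map_inv₀, map_pow, ← Complex.star_def]
  have hW' := star_ne_zero.2 hW
  rw [mul_pow]
  field_simp

lemma inner_originD_sq_smul (u : Circle) (Z : domainD) (hZ : (u : ℂ) ^ 2 • (Z : Mat2) ∈ domainD) :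
    ⟪coherentState I originD, coherentState I ⟨(u : ℂ) ^ 2 • (Z : Mat2), hZ⟩⟫_ℂ =
      ⟪coherentState I originD, coherentState I Z⟫_ℂ := by
  have horigin : actD (rotation u) originD = originD :=
    Subtype.ext (by simp [actD, originD, moebius_rotation])
  have hact : actD (rotation u) Z = ⟨(u : ℂ) ^ 2 • (Z : Mat2), hZ⟩ :=
    Subtype.ext (moebius_rotation u Z)
  have hinner := inner_coherentState_actD I (rotation u) originD Z
  rwa [horigin, hact, autFactor_rotation, autFactor_rotation, Complex.star_def, Complex.conj_mul',
    norm_pow, Complex.norm_conj, Circle.norm_coe, one_pow, Complex.ofReal_one, one_pow, one_pow,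
    one_mul] at hinner

lemma diffContOnCl_slice {f : Mat2 → ℂ} (hf : DifferentiableOn ℂ f domainD) {Z : Mat2}
    (hZ : Z ∈ domainD) : DiffContOnCl ℂ (fun s : ℂ => f (s • Z)) (ball 0 1) := by
  apply DifferentiableOn.diffContOnCl
  rw [closure_ball _ one_ne_zero]
  exact hf.comp (by fun_prop) fun s hs => smul_mem_domainD hZ (by simpa using hs)

-- `⟨0|Z⟩` is holomorphic in `Z` and invariant under `Z ↦ e^{iθ} Z`, so the mean value property
-- shows that it equals its value at `0`.
lemma inner_originD (Z : domainD) :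
    ⟪coherentState I originD, coherentState I Z⟫_ℂ = vacuumNormSq I := by
  set f : Mat2 → ℂ := holFun (I (coherentState I originD))
  have hcircle : ∀ s ∈ sphere (0 : ℂ) |1|, f (s • (Z : Mat2)) = f Z := by
    intro s hs
    have hs' : ‖s‖ = 1 := by simpa using hs
    obtain ⟨u, hu⟩ := IsAlgClosed.exists_pow_nat_eq s (n := 2) two_pos
    have hu' : ‖u‖ = 1 := by
      rwa [← hu, norm_pow, pow_eq_one_iff_of_nonneg (norm_nonneg _) two_ne_zero] at hs'
    have hrot := inner_originD_sq_smul I ⟨u, mem_sphere_zero_iff_norm.2 hu'⟩ Z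
      (by simpa only [hu] using smul_mem_domainD Z.2 hs'.le)
    simpa only [inner_coherentState, hu] using hrot
  have hmean : Real.circleAverage (fun s : ℂ => f (s • (Z : Mat2))) 0 1 =
      f ((0 : ℂ) • (Z : Mat2)) :=
    DiffContOnCl.circleAverage (by simpa using diffContOnCl_slice (differentiableOn_holFun _) Z.2)
  rw [Real.circleAverage_congr_sphere (f₂ := fun _ => f Z) hcircle, Real.circleAverage_const,
    zero_smul] at hmean
  rwa [vacuumNormSq, inner_coherentState, inner_coherentState]

lemma inner_mul_detKernel (W Z : domainD) :
    ⟪coherentState I W, coherentState I Z⟫_ℂ * detKernel W Z ^ lam = vacuumNormSq I := by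
  obtain ⟨g, hg⟩ := exists_actD_eq_originD W
  rw [detKernel_eq_autFactor hg, mul_comm, ← inner_coherentState_actD, hg, inner_originD]

lemma inner_coherentState_ne_zero (W Z : domainD) :
    ⟪coherentState I W, coherentState I Z⟫_ℂ ≠ 0 :=
  left_ne_zero_of_mul (inner_mul_detKernel I W Z ▸ vacuumNormSq_ne_zero I)

end CoherentStates

section SubalgebraMatrix

open Matrix

variable {R ι n : Type*} [CommRing R] [Fintype n] [DecidableEq n] {A : Subalgebra R (ι → R)}
  {F : ι → Matrix n n R}

lemma det_mem_of_apply_mem (hF : ∀ i j, (fun x => F x i j) ∈ A) : (fun x => (F x).det) ∈ A := by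
  have hdet : (fun x => (F x).det) =
      ∑ σ : Equiv.Perm n, Equiv.Perm.sign σ • ∏ i, fun x => F x (σ i) i := by
    ext x
    simp [det_apply, Finset.sum_apply, Finset.prod_apply]
  rw [hdet]
  exact sum_mem fun σ _ => zsmul_mem (prod_mem fun i _ => hF (σ i) i) _

lemma adjugate_apply_mem_of_apply_mem (hF : ∀ i j, (fun x => F x i j) ∈ A) (k l : n) :
    (fun x => (F x).adjugate k l) ∈ A := by
  simp only [adjugate_apply]
  refine det_mem_of_apply_mem fun i j => ?_
  simp only [updateRow_apply]
  split_ifs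
  exacts [A.algebraMap_mem (Pi.single (M := fun _ => R) k 1 j), hF i j]

end SubalgebraMatrix

section Annihilation

variable {lam : ℕ} [Fact (3 < lam)] {H : Type*} [NormedAddCommGroup H] [InnerProductSpace ℂ H]
  [CompleteSpace H]

lemma coordinate_mem_boundedHolomorphic (k l : Fin 2) :
    (fun Z : Mat2 => Z k l) ∈ boundedHolomorphic :=
  ⟨by fun_prop, 1, fun _ hZ => (norm_apply_lt_one hZ k l).le⟩

variable (I : H ≃ₗᵢ⋆[ℂ] bergmanSpace lam)

/-- The coordinate annihilation operator `a_{kl}`. -/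
def coordOp (k l : Fin 2) : H →L[ℂ] H :=
  (existsUnique_annihilation I (coordinate_mem_boundedHolomorphic k l)).choose

lemma hasSymbol_coordOp (k l : Fin 2) :
    HasSymbol (coherentState I) (coordOp I k l) fun Z => Z.1 k l :=
  (existsUnique_annihilation I (coordinate_mem_boundedHolomorphic k l)).choose_spec.1

lemma annihilationOperators_coordinateFunctions :
    annihilationOperators I coordinateFunctions = {T | ∃ k l, T = coordOp I k l} := by
  ext T
  constructor
  · rintro ⟨_, ⟨k, l, rfl⟩, hT⟩
    exact ⟨k, l, HasSymbol.unique (dense_span_coherentState I) hT (hasSymbol_coordOp I k l)⟩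
  · rintro ⟨k, l, rfl⟩
    exact ⟨_, ⟨k, l, rfl⟩, hasSymbol_coordOp I k l⟩

lemma polarizationPol_le {A : Subalgebra ℂ (H →L[ℂ] H)} (hA : IsClosed (A : Set (H →L[ℂ] H)))
    (h : ∀ k l, coordOp I k l ∈ A) : polarizationPol I ≤ A := by
  refine Subalgebra.topologicalClosure_minimal (Algebra.adjoin_le ?_) hA
  rw [annihilationOperators_coordinateFunctions]
  rintro _ ⟨k, l, rfl⟩
  exact h k l

lemma phaseSpacePol_le {M : StarSubalgebra ℂ (H →L[ℂ] H)} (hM : IsClosed (M : Set (H →L[ℂ] H)))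
    (h : ∀ k l, coordOp I k l ∈ M) : phaseSpacePol I ≤ M :=
  StarSubalgebra.topologicalClosure_minimal
    (StarAlgebra.adjoin_le (polarizationPol_le I (A := M.toSubalgebra) hM h)) hM

lemma isClosed_phaseSpacePol : IsClosed (phaseSpacePol I : Set (H →L[ℂ] H)) :=
  StarSubalgebra.isClosed_topologicalClosure _

lemma isClosed_phaseSpace : IsClosed (phaseSpace I : Set (H →L[ℂ] H)) :=
  StarSubalgebra.isClosed_topologicalClosure _

lemma coordOp_mem_phaseSpacePol (k l : Fin 2) : coordOp I k l ∈ phaseSpacePol I := by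
  have hpol : coordOp I k l ∈ polarizationPol I :=
    Subalgebra.le_topologicalClosure _ <| Algebra.subset_adjoin <| by
      rw [annihilationOperators_coordinateFunctions]
      exact ⟨k, l, rfl⟩
  exact StarSubalgebra.le_topologicalClosure _ (StarAlgebra.subset_adjoin ℂ _ hpol)

lemma phaseSpacePol_le_phaseSpace : phaseSpacePol I ≤ phaseSpace I :=
  phaseSpacePol_le I (isClosed_phaseSpace I) fun k l =>
    StarSubalgebra.le_topologicalClosure _ <| StarAlgebra.subset_adjoin ℂ _
      ⟨_, coordinate_mem_boundedHolomorphic k l, hasSymbol_coordOp I k l⟩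

/-- The algebra of the functions `f` on `𝔻` with `a(f) ∈ ℳ⁺⁺_pol`. -/
abbrev polSymbols : Subalgebra ℂ (domainD → ℂ) :=
  symbolAlgebra (coherentState I) (phaseSpacePol I).toSubalgebra

lemma coordinate_mem_polSymbols (k l : Fin 2) : (fun Z : domainD => Z.1 k l) ∈ polSymbols I :=
  ⟨_, coordOp_mem_phaseSpacePol I k l, hasSymbol_coordOp I k l⟩

-- `det (E - W* Z)` is a polynomial in the entries of `W*` and `Z`, so multiplication of the kernel
-- `⟨W| X |Z⟩` by it can be carried out with the `a_{kl}` and their adjoints.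
lemma exists_inner_eq_detKernel_mul {X : H →L[ℂ] H} (hX : X ∈ phaseSpacePol I) :
    ∃ Y ∈ phaseSpacePol I, ∀ W Z, ⟪coherentState I W, Y (coherentState I Z)⟫_ℂ =
      detKernel W Z * ⟪coherentState I W, X (coherentState I Z)⟫_ℂ := by
  obtain ⟨D, hD, hdet⟩ : (fun Z : domainD => (Matrix.of Z.1).det) ∈ polSymbols I :=
    det_mem_of_apply_mem (coordinate_mem_polSymbols I)
  have hconj : ∀ T ∈ phaseSpacePol I, star T * X * T ∈ phaseSpacePol I := fun T hT =>
    mul_mem (mul_mem (star_mem hT) hX) hT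
  refine ⟨X - ∑ k, ∑ l, star (coordOp I k l) * X * coordOp I k l + star D * X * D,
    add_mem (sub_mem hX (sum_mem fun k _ => sum_mem fun l _ =>
      hconj _ (coordOp_mem_phaseSpacePol I k l))) (hconj D hD), fun W Z => ?_⟩
  simp only [_root_.add_apply, _root_.sub_apply, _root_.sum_apply, inner_add_right,
    inner_sub_right, inner_sum, (hasSymbol_coordOp I _ _).inner_star_mul_mul
      (hasSymbol_coordOp I _ _), hdet.inner_star_mul_mul hdet, ← Finset.sum_mul]
  rw [detKernel_eq]
  ring

lemma exists_inner_eq_detKernel_pow_mul (n : ℕ) :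
    ∃ X ∈ phaseSpacePol I, ∀ W Z, ⟪coherentState I W, X (coherentState I Z)⟫_ℂ =
      detKernel W Z ^ n * ⟪coherentState I W, coherentState I Z⟫_ℂ := by
  induction n with
  | zero => exact ⟨1, one_mem _, by simp⟩
  | succ n ih =>
    obtain ⟨X, hX, hXn⟩ := ih
    obtain ⟨Y, hY, hYX⟩ := exists_inner_eq_detKernel_mul I hX
    exact ⟨Y, hY, fun W Z => by rw [hYX, hXn, pow_succ', mul_assoc]⟩

lemma inner_originD_right (Z : domainD) :
    ⟪coherentState I Z, coherentState I originD⟫_ℂ = vacuumNormSq I := by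
  rw [← inner_conj_symm, inner_originD, vacuumNormSq, inner_conj_symm]

lemma rankOne_originD_mem : InnerProductSpace.rankOne ℂ (coherentState I originD)
    (coherentState I originD) ∈ phaseSpacePol I := by
  obtain ⟨X, hX, hXlam⟩ := exists_inner_eq_detKernel_pow_mul I lam
  have hrank : InnerProductSpace.rankOne ℂ (coherentState I originD) (coherentState I originD) =
      vacuumNormSq I • X := by
    refine clm_eq_of_inner_eq (dense_span_coherentState I) (dense_span_coherentState I)
      fun W Z => ?_
    rw [InnerProductSpace.inner_right_rankOne_apply, inner_originD, inner_originD_right,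
      _root_.smul_apply, inner_smul_right, hXlam, mul_comm (_ ^ _), inner_mul_detKernel]
  exact hrank ▸ SMulMemClass.smul_mem _ hX

end Annihilation

section ConformalInvariance

open Matrix

variable {lam : ℕ} [Fact (3 < lam)] {H : Type*} [NormedAddCommGroup H] [InnerProductSpace ℂ H]
  [CompleteSpace H] (I : H ≃ₗᵢ⋆[ℂ] bergmanSpace lam)

lemma affine_apply_mem_polSymbols (P Q : Matrix (Fin 2) (Fin 2) ℂ) (i j : Fin 2) :
    (fun Z : domainD => (P * of Z.1 + Q) i j) ∈ polSymbols I := by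
  have haffine : (fun Z : domainD => (P * of Z.1 + Q) i j) =
      ∑ k, P i k • (fun Z : domainD => Z.1 k j) + algebraMap ℂ (domainD → ℂ) (Q i j) := by
    ext Z
    simp [Matrix.mul_apply]
  rw [haffine]
  exact add_mem (sum_mem fun k _ => Subalgebra.smul_mem _ (coordinate_mem_polSymbols I k j) _)
    (Subalgebra.algebraMap_mem _ _)

lemma autFactor_mem_polSymbols (h : Mat22) :
    (fun Z : domainD => autFactor h Z) ∈ polSymbols I :=
  det_mem_of_apply_mem (affine_apply_mem_polSymbols I h.toBlocks₂₁ h.toBlocks₂₂)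

lemma inv_autFactor_mem_boundedHolomorphic (g : SU22) :
    (fun Z => (autFactor g.1.1 Z)⁻¹) ∈ boundedHolomorphic := by
  have hg := isTwistorUnitary_coe g
  obtain ⟨C, hC⟩ := (isCompact_closedBall (0 : Mat2) 1).exists_bound_of_continuousOn
    (differentiable_autFactor (g⁻¹ : SU22).1.1).continuous.continuousOn
  refine ⟨(differentiable_autFactor _).differentiableOn.inv fun Z hZ => hg.autFactor_ne_zero hZ,
    C, fun Z hZ => ?_⟩
  have hinv : autFactor (g⁻¹ : SU22).1.1 (moebius g.1.1 Z) = (autFactor g.1.1 Z)⁻¹ := by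
    have hone : (g⁻¹ : SU22).1.1 * g.1.1 = 1 :=
      congrArg (fun g : SU22 => g.1.1) (inv_mul_cancel g)
    exact eq_inv_of_mul_eq_one_left (by rw [← hg.autFactor_mul hZ, hone, autFactor_one])
  simpa only [hinv] using hC _ (domainD_subset_closedBall (hg.moebius_mem hZ))

lemma inv_autFactor_mem_polSymbols (g : SU22) :
    (fun Z : domainD => autFactor g.1.1 Z)⁻¹ ∈ polSymbols I := by
  obtain ⟨L, hL, -⟩ := existsUnique_annihilation I (inv_autFactor_mem_boundedHolomorphic g)
  exact inv_mem_symbolAlgebra (dense_span_coherentState I) (isClosed_phaseSpacePol I)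
    (autFactor_mem_polSymbols I g.1.1)
    (fun Z => (isTwistorUnitary_coe g).autFactor_ne_zero Z.2) hL

lemma moebius_apply_mem_polSymbols (g : SU22) (k l : Fin 2) :
    (fun Z : domainD => moebius g.1.1 Z k l) ∈ polSymbols I := by
  have hmoebius : (fun Z : domainD => moebius g.1.1 Z k l) =
      ∑ j, (fun Z : domainD => numer g.1.1 Z k j) *
        ((fun Z : domainD => autFactor g.1.1 Z)⁻¹ *
          fun Z : domainD => (denom g.1.1 Z).adjugate j l) := by
    ext Z
    rw [← of_apply (moebius _ _), of_moebius, Matrix.inv_def, Ring.inverse_eq_inv', ← autFactor_eq,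
      Matrix.mul_apply]
    simp
  rw [hmoebius]
  exact sum_mem fun j _ => mul_mem (affine_apply_mem_polSymbols I _ _ k j) <|
    mul_mem (inv_autFactor_mem_polSymbols I g)
      (adjugate_apply_mem_of_apply_mem (affine_apply_mem_polSymbols I _ _) j l)

lemma HasSymbol.conj_discreteSeries {I : H ≃ₗᵢ⋆[ℂ] bergmanSpace lam} {T : H →L[ℂ] H}
    {f : domainD → ℂ} (hT : HasSymbol (coherentState I) T f) (g : SU22) :
    HasSymbol (coherentState I) ((discreteSeries I g : H →L[ℂ] H) * T *
      ContinuousLinearMap.adjoint (discreteSeries I g : H →L[ℂ] H)) fun Z => f (actD g⁻¹ Z) := by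
  intro Z
  have hcancel : (discreteSeries I g : H →L[ℂ] H)
      ((discreteSeries I g⁻¹ : H →L[ℂ] H) (coherentState I Z)) = coherentState I Z := by
    rw [← mul_apply_eq_comp, ← Submonoid.coe_mul, ← map_mul, mul_inv_cancel, map_one]
    rfl
  rw [discreteSeries_coherentState, map_smul] at hcancel
  rw [adjoint_discreteSeries, mul_apply_eq_comp, mul_apply_eq_comp, discreteSeries_coherentState,
    map_smul, hT, map_smul, map_smul, smul_comm, hcancel]

lemma conj_discreteSeries_mem (g : SU22) {X : H →L[ℂ] H} (hX : X ∈ phaseSpacePol I) :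
    (discreteSeries I g : H →L[ℂ] H) * X *
      ContinuousLinearMap.adjoint (discreteSeries I g : H →L[ℂ] H) ∈ phaseSpacePol I := by
  let φ : (H →L[ℂ] H) ≃⋆ₐ[ℂ] (H →L[ℂ] H) := Unitary.conjStarAlgAut ℂ _ (discreteSeries I g)
  have hφ : ⇑φ = fun Y => (discreteSeries I g : H →L[ℂ] H) * Y *
      ContinuousLinearMap.adjoint (discreteSeries I g : H →L[ℂ] H) :=
    funext (Unitary.conjStarAlgAut_apply _)
  have hcont : Continuous φ := by
    rw [hφ]
    fun_prop
  have hle : phaseSpacePol I ≤ (phaseSpacePol I).comap (StarAlgHomClass.toStarAlgHom φ) := by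
    refine phaseSpacePol_le I ((isClosed_phaseSpacePol I).preimage hcont) fun k l => ?_
    obtain ⟨T, hTM, hT⟩ := moebius_apply_mem_polSymbols I g⁻¹ k l
    change φ (coordOp I k l) ∈ phaseSpacePol I
    rw [hφ]
    exact Set.mem_of_eq_of_mem
      (((hasSymbol_coordOp I k l).conj_discreteSeries g).unique (dense_span_coherentState I) hT) hTM
  have hmem : φ X ∈ phaseSpacePol I := hle hX
  rwa [hφ] at hmem

lemma inner_coherentState_mem_polSymbols (W : domainD) :
    (fun Z => ⟪coherentState I W, coherentState I Z⟫_ℂ) ∈ polSymbols I := by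
  obtain ⟨g, hg⟩ := exists_actD_eq_originD W
  have hkernel : (fun Z => ⟪coherentState I W, coherentState I Z⟫_ℂ) =
      (vacuumNormSq I / star (autFactor g.1.1 W) ^ lam) •
        ((fun Z : domainD => autFactor g.1.1 Z)⁻¹) ^ lam := by
    ext Z
    have hW := star_ne_zero.2 ((isTwistorUnitary_coe g).autFactor_ne_zero W.2)
    have hZ := (isTwistorUnitary_coe g).autFactor_ne_zero Z.2
    rw [← inner_mul_detKernel I W Z, detKernel_eq_autFactor hg, mul_pow]
    simp only [Pi.smul_apply, Pi.pow_apply, Pi.inv_apply, smul_eq_mul, inv_pow]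
    field_simp
  rw [hkernel]
  exact Subalgebra.smul_mem _ (pow_mem (inv_autFactor_mem_polSymbols I g) _) _

lemma rankOne_coherentState_mem (W Z : domainD) : InnerProductSpace.rankOne ℂ (coherentState I W)
    (coherentState I Z) ∈ phaseSpacePol I := by
  obtain ⟨S, hSM, hS⟩ := inner_coherentState_mem_polSymbols I W
  obtain ⟨T, hTM, hT⟩ := inner_coherentState_mem_polSymbols I Z
  have hrank : InnerProductSpace.rankOne ℂ (coherentState I W) (coherentState I Z) =
      (vacuumNormSq I ^ 2)⁻¹ • (star S * InnerProductSpace.rankOne ℂ (coherentState I originD)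
        (coherentState I originD) * T) := by
    refine clm_eq_of_inner_eq (dense_span_coherentState I) (dense_span_coherentState I)
      fun V V' => ?_
    have hvac := vacuumNormSq_ne_zero I
    rw [_root_.smul_apply, inner_smul_right, hS.inner_star_mul_mul hT,
      InnerProductSpace.inner_right_rankOne_apply, InnerProductSpace.inner_right_rankOne_apply,
      inner_originD, inner_originD_right, Complex.star_def, inner_conj_symm]
    field_simp
  exact hrank ▸ SMulMemClass.smul_mem _
    (mul_mem (mul_mem (star_mem hSM) (rankOne_originD_mem I)) hTM)

end ConformalInvariance

section Polarization

variable {lam : ℕ} [Fact (3 < lam)] {H : Type*} [NormedAddCommGroup H] [InnerProductSpace ℂ H]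
  {I : H ≃ₗᵢ⋆[ℂ] bergmanSpace lam} {T : H →L[ℂ] H} {f g : domainD → ℂ}

lemma exists_hasSymbol_of_mem_polarization (hT : T ∈ polarization I) :
    ∃ f, HasSymbol (coherentState I) T f := by
  obtain ⟨f, -, hf⟩ := hT
  exact ⟨fun Z => f Z, hf⟩

lemma smul_one_mem_polarization (c : ℂ) : c • 1 ∈ polarization I :=
  ⟨fun _ => c, ⟨differentiableOn_const c, ‖c‖, fun _ _ => le_rfl⟩, fun _ => rfl⟩

variable [CompleteSpace H]

lemma exists_hasSymbol_of_mem_polarizationPol (hT : T ∈ polarizationPol I) :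
    ∃ f, HasSymbol (coherentState I) T f :=
  polarizationPol_le I (isClosed_eigenAlgebra (coherentState I))
    (fun k l => ⟨_, hasSymbol_coordOp I k l⟩) hT

lemma HasSymbol.exists_differentiableOn (hT : HasSymbol (coherentState I) T f) :
    ∃ F : Mat2 → ℂ, DifferentiableOn ℂ F domainD ∧ ∀ Z : domainD, F Z = f Z :=
  ⟨holFun (I (ContinuousLinearMap.adjoint T (constState I))), differentiableOn_holFun _, fun Z => by
    rw [← inner_coherentState, ContinuousLinearMap.adjoint_inner_left, hT, inner_smul_right,
      inner_constState, mul_one]⟩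

lemma HasSymbol.mem_scalarOperators (hT : HasSymbol (coherentState I) T f)
    (hT' : HasSymbol (coherentState I) (ContinuousLinearMap.adjoint T) g) :
    T ∈ scalarOperators H := by
  have hfg (W Z : domainD) : f Z = star (g W) := by
    have h := ContinuousLinearMap.adjoint_inner_left T (coherentState I Z) (coherentState I W)
    rw [hT, hT', inner_smul_left, inner_smul_right] at h
    exact (mul_right_cancel₀ (inner_coherentState_ne_zero I W Z) h).symm
  have hconst : algebraMap ℂ (domainD → ℂ) (f originD) = f :=
    funext fun Z => (hfg Z originD).trans (hfg Z Z).symm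
  refine ⟨f originD, HasSymbol.unique (dense_span_coherentState I) ?_ (hconst ▸ hT)⟩
  rw [hconst]
  exact hconst ▸ hasSymbol_algebraMap _ (f originD)

lemma inter_adjointSet_eq_scalarOperators {A : Set (H →L[ℂ] H)}
    (hA : ∀ T ∈ A, ∃ f, HasSymbol (coherentState I) T f) (hscalar : ∀ c : ℂ, c • 1 ∈ A) :
    A ∩ adjointSet A = scalarOperators H := by
  refine Set.Subset.antisymm ?_ ?_
  · rintro _ ⟨hT, S, hS, rfl⟩
    obtain ⟨f, hf⟩ := hA _ hT
    obtain ⟨g, hg⟩ := hA _ hS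
    exact hf.mem_scalarOperators (by rwa [ContinuousLinearMap.adjoint_adjoint])
  · rintro _ ⟨c, rfl⟩
    refine ⟨hscalar c, star c • 1, hscalar _, ?_⟩
    rw [← ContinuousLinearMap.star_eq_adjoint, star_smul, star_star, star_one]

variable (I)

lemma polarizationPol_inter_adjointSet :
    (polarizationPol I : Set (H →L[ℂ] H)) ∩ adjointSet (polarizationPol I : Set (H →L[ℂ] H)) =
      scalarOperators H :=
  inter_adjointSet_eq_scalarOperators (fun _ => exists_hasSymbol_of_mem_polarizationPol)
    fun c => Subalgebra.smul_mem _ (one_mem _) c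

lemma polarization_inter_adjointSet :
    polarization I ∩ adjointSet (polarization I) = scalarOperators H :=
  inter_adjointSet_eq_scalarOperators (fun _ => exists_hasSymbol_of_mem_polarization)
    smul_one_mem_polarization

end Polarization

section NormalizedCoherentStates

open Complex (UnitDisc)

/-- The point `diag(t, s)` of `𝔻`. -/
def diagD (t s : UnitDisc) : domainD :=
  ⟨diagPoint t s, diagPoint_mem t.norm_lt_one s.norm_lt_one⟩

lemma weight_diagD (t s : UnitDisc) :
    weight (diagD t s) = (1 - ‖(t : ℂ)‖ ^ 2) * (1 - ‖(s : ℂ)‖ ^ 2) := by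
  have h := detKernel_self (diagD t s).2
  rw [diagD, detKernel_diagPoint, Complex.star_def, Complex.conj_mul', Complex.conj_mul'] at h
  exact_mod_cast h.symm

variable {lam : ℕ} [Fact (3 < lam)] {H : Type*} [NormedAddCommGroup H] [InnerProductSpace ℂ H]
  (I : H ≃ₗᵢ⋆[ℂ] bergmanSpace lam)

/-- The normalized coherent state at `Z`. -/
def unitState (Z : domainD) : H := ((‖coherentState I Z‖⁻¹ : ℝ) : ℂ) • coherentState I Z

lemma norm_coherentState_pos (Z : domainD) : 0 < ‖coherentState I Z‖ :=
  norm_pos_iff.2 (coherentState_ne_zero I Z)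

lemma norm_unitState (Z : domainD) : ‖unitState I Z‖ = 1 := by
  rw [unitState, norm_smul, Complex.norm_real, norm_inv, norm_norm,
    inv_mul_cancel₀ (norm_coherentState_pos I Z).ne']

lemma coherentState_eq_smul_unitState (Z : domainD) :
    coherentState I Z = (‖coherentState I Z‖ : ℂ) • unitState I Z := by
  rw [unitState, smul_smul, ← Complex.ofReal_mul, mul_inv_cancel₀ (norm_coherentState_pos I Z).ne',
    Complex.ofReal_one, one_smul]

variable {I} {T : H →L[ℂ] H} {f : domainD → ℂ}

lemma HasSymbol.hasSymbol_unitState (hT : HasSymbol (coherentState I) T f) :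
    HasSymbol (unitState I) T f := fun Z => by
  rw [unitState, map_smul, hT, smul_comm]

lemma HasSymbol.norm_apply_unitState (hT : HasSymbol (coherentState I) T f) (Z : domainD) :
    ‖T (unitState I Z)‖ = ‖f Z‖ := by
  rw [hT.hasSymbol_unitState, norm_smul, norm_unitState, mul_one]

variable (I) [CompleteSpace H]

lemma norm_sq_mul_weight (Z : domainD) :
    ‖coherentState I Z‖ ^ 2 * weight Z ^ lam = ‖vacuumNormSq I‖ := by
  rw [← inner_mul_detKernel I Z Z, detKernel_self Z.2, inner_self_eq_norm_sq_to_K, norm_mul,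
    norm_pow, norm_pow, Complex.norm_real, Real.norm_of_nonneg (weight_pos Z.2).le]
  simp

lemma norm_inner_unitState_sq_mul (W Z : domainD) :
    ‖⟪unitState I W, unitState I Z⟫_ℂ‖ ^ 2 * (‖detKernel W Z‖ ^ 2) ^ lam =
      (weight W * weight Z) ^ lam := by
  have hWZ := congrArg norm (inner_mul_detKernel I W Z)
  have hinner : ‖⟪coherentState I W, coherentState I Z⟫_ℂ‖ =
      ‖coherentState I W‖ * ‖coherentState I Z‖ * ‖⟪unitState I W, unitState I Z⟫_ℂ‖ := by
    conv_lhs => rw [coherentState_eq_smul_unitState I W, coherentState_eq_smul_unitState I Z]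
    rw [inner_smul_left, inner_smul_right]
    simp [mul_assoc]
  rw [norm_mul, norm_pow, hinner] at hWZ
  refine mul_left_cancel₀ (a := (‖coherentState I W‖ * ‖coherentState I Z‖) ^ 2)
    (pow_pos (mul_pos (norm_coherentState_pos I W) (norm_coherentState_pos I Z)) 2).ne' ?_
  calc (‖coherentState I W‖ * ‖coherentState I Z‖) ^ 2 *
        (‖⟪unitState I W, unitState I Z⟫_ℂ‖ ^ 2 * (‖detKernel W Z‖ ^ 2) ^ lam)
      = (‖coherentState I W‖ * ‖coherentState I Z‖ * ‖⟪unitState I W, unitState I Z⟫_ℂ‖ *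
          ‖detKernel W Z‖ ^ lam) ^ 2 := by ring
    _ = (‖coherentState I W‖ ^ 2 * weight W ^ lam) *
          (‖coherentState I Z‖ ^ 2 * weight Z ^ lam) := by
        rw [hWZ, norm_sq_mul_weight, norm_sq_mul_weight, sq]
    _ = (‖coherentState I W‖ * ‖coherentState I Z‖) ^ 2 * (weight W * weight Z) ^ lam := by ring

lemma one_sub_norm_le_norm_detKernel_diagD (W : domainD) (t : UnitDisc) :
    1 - ‖(W : Mat2) 0 0‖ ≤ ‖detKernel W (diagD t 0)‖ := by
  have hker : detKernel W (diagD t 0) = 1 - star ((W : Mat2) 0 0) * t := by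
    simp [detKernel_eq, diagD, diagPoint]
  calc 1 - ‖(W : Mat2) 0 0‖ ≤ 1 - ‖star ((W : Mat2) 0 0) * (t : ℂ)‖ := by
        rw [norm_mul, norm_star]
        exact sub_le_sub_left (mul_le_of_le_one_right (norm_nonneg _) t.norm_lt_one.le) 1
    _ ≤ ‖1 - star ((W : Mat2) 0 0) * (t : ℂ)‖ := by
        simpa using norm_sub_norm_le 1 (star ((W : Mat2) 0 0) * (t : ℂ))
    _ = ‖detKernel W (diagD t 0)‖ := by rw [hker]

lemma norm_inner_unitState_diagD_sq_le (W : domainD) (t : UnitDisc) :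
    ‖⟪unitState I W, unitState I (diagD t 0)⟫_ℂ‖ ^ 2 ≤
      (weight W * (1 - ‖(t : ℂ)‖ ^ 2) / (1 - ‖(W : Mat2) 0 0‖) ^ 2) ^ lam := by
  have hW : 0 < 1 - ‖(W : Mat2) 0 0‖ := sub_pos.2 (norm_apply_lt_one W.2 0 0)
  have hweight : weight (diagD t 0) = 1 - ‖(t : ℂ)‖ ^ 2 := by simp [weight_diagD]
  rw [div_pow, le_div_iff₀ (by positivity), ← hweight, ← norm_inner_unitState_sq_mul I]
  gcongr
  exact one_sub_norm_le_norm_detKernel_diagD W t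

lemma tendsto_inner_unitState_diagD (x : H) :
    Tendsto (fun t : UnitDisc => ⟪x, unitState I (diagD t 0)⟫_ℂ)
      (comap (fun t : UnitDisc => ‖(t : ℂ)‖) (𝓝[<] 1)) (𝓝 0) := by
  refine tendsto_inner_zero_of_dense_span (dense_span_coherentState I)
    (fun t : UnitDisc => (norm_unitState I (diagD t 0)).le) (fun W => ?_) x
  have hbound : Tendsto (fun t : UnitDisc =>
      (weight W * (1 - ‖(t : ℂ)‖ ^ 2) / (1 - ‖(W : Mat2) 0 0‖) ^ 2) ^ lam)
      (comap (fun t : UnitDisc => ‖(t : ℂ)‖) (𝓝[<] 1)) (𝓝 0) := by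
    have hcont : Continuous fun r : ℝ =>
      (weight W * (1 - r ^ 2) / (1 - ‖(W : Mat2) 0 0‖) ^ 2) ^ lam := by fun_prop
    have hlam : lam ≠ 0 := (three_pos.trans (Fact.out : 3 < lam)).ne'
    simpa [Function.comp_def, hlam] using
      (hcont.tendsto 1).comp (tendsto_comap.mono_right nhdsWithin_le_nhds)
  have hsq := squeeze_zero (fun _ => sq_nonneg _) (norm_inner_unitState_diagD_sq_le I W) hbound
  have hunit : Tendsto (fun t => ⟪unitState I W, unitState I (diagD t 0)⟫_ℂ)
      (comap (fun t : UnitDisc => ‖(t : ℂ)‖) (𝓝[<] 1)) (𝓝 0) :=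
    tendsto_zero_iff_norm_tendsto_zero.2 (by simpa using hsq.sqrt)
  rw [coherentState_eq_smul_unitState I W]
  simpa [inner_smul_left] using hunit.const_mul (‖coherentState I W‖ : ℂ)

variable {I}

lemma exists_radius_forall_norm_apply_unitState_lt (hT : T ∈ compactOperators H) {ε : ℝ}
    (hε : 0 < ε) : ∃ r ∈ Set.Ioo (0 : ℝ) 1, ∀ t : UnitDisc, ‖(t : ℂ)‖ = r →
      ‖T (unitState I (diagD t 0))‖ < ε := by
  have hlim := tendsto_apply_zero_of_isCompactOperator hT
    (fun t : UnitDisc => (norm_unitState I (diagD t 0)).le) (tendsto_inner_unitState_diagD I)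
  have hev := eventually_comap.1 (hlim.norm.eventually_lt_const (by rwa [norm_zero]))
  obtain ⟨r, hr, hr01⟩ := (hev.and (Ioo_mem_nhdsLT one_pos)).exists
  exact ⟨r, hr01, hr⟩

end NormalizedCoherentStates

section BoundaryBehaviour

open Complex (UnitDisc)

variable {lam : ℕ} [Fact (3 < lam)] {H : Type*} [NormedAddCommGroup H] [InnerProductSpace ℂ H]
  [CompleteSpace H] {I : H ≃ₗᵢ⋆[ℂ] bergmanSpace lam} {T : H →L[ℂ] H} {f : domainD → ℂ}

lemma HasSymbol.apply_originD_eq_zero (hf : HasSymbol (coherentState I) T f)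
    (hT : T ∈ compactOperators H) : f originD = 0 := by
  refine norm_le_zero_iff.1 (le_of_forall_pos_le_add fun ε hε => ?_)
  obtain ⟨F, hF, hFf⟩ := hf.exists_differentiableOn
  obtain ⟨r, ⟨hr0, hr1⟩, hr⟩ :=
    exists_radius_forall_norm_apply_unitState_lt (I := I) hT hε
  have hrD : diagPoint (r : ℂ) 0 ∈ domainD :=
    diagPoint_mem (by rwa [Complex.norm_real, Real.norm_of_nonneg hr0.le]) (by simp)
  have hcircle : ∀ s ∈ frontier (ball (0 : ℂ) 1), ‖F (s • diagPoint (r : ℂ) 0)‖ ≤ ε := by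
    intro s hs
    rw [frontier_ball _ one_ne_zero, mem_sphere_zero_iff_norm] at hs
    have hnorm : ‖s * (r : ℂ)‖ = r := by
      rw [norm_mul, hs, one_mul, Complex.norm_real, Real.norm_of_nonneg hr0.le]
    let t : UnitDisc := UnitDisc.mk (s * r) (hnorm.trans_lt hr1)
    have hpoint : s • diagPoint (r : ℂ) 0 = (diagD t 0 : Mat2) := by
      ext i j
      fin_cases i <;> fin_cases j <;> simp [diagPoint, diagD, t]
    rw [hpoint, hFf, ← hf.norm_apply_unitState]
    exact (hr t hnorm).le
  have hmax := Complex.norm_le_of_forall_mem_frontier_norm_le isBounded_ball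
    (diffContOnCl_slice hF hrD) hcircle (subset_closure (mem_ball_self one_pos))
  rw [zero_smul] at hmax
  rw [← hFf, zero_add]
  exact hmax

lemma HasSymbol.eq_zero_of_compact (hf : HasSymbol (coherentState I) T f)
    (hT : T ∈ compactOperators H) : T = 0 := by
  have hzero : f = 0 := funext fun Z => by
    obtain ⟨g, hg⟩ := exists_actD_eq_originD Z
    have hcompact : (discreteSeries I g : H →L[ℂ] H) * T *
        ContinuousLinearMap.adjoint (discreteSeries I g : H →L[ℂ] H) ∈ compactOperators H :=
      (IsCompactOperator.clm_comp (show IsCompactOperator T from hT)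
        (discreteSeries I g : H →L[ℂ] H)).comp_clm
          (ContinuousLinearMap.adjoint (discreteSeries I g : H →L[ℂ] H))
    have horigin := (hf.conj_discreteSeries g).apply_originD_eq_zero hcompact
    rwa [← hg, actD_inv_actD] at horigin
  refine hf.unique (dense_span_coherentState I) fun Z => ?_
  rw [hzero, Pi.zero_apply, zero_smul, _root_.zero_apply]

lemma inter_compactOperators_eq_singleton_zero {A : Set (H →L[ℂ] H)}
    (hA : ∀ T ∈ A, ∃ f, HasSymbol (coherentState I) T f) (hzero : 0 ∈ A) :
    A ∩ compactOperators H = {0} :=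
  Set.Subset.antisymm (fun T ⟨hT, hc⟩ => (hA T hT).elim fun _ hf => hf.eq_zero_of_compact hc)
    (Set.singleton_subset_iff.2 ⟨hzero, isCompactOperator_zero⟩)

variable (I)

lemma polarizationPol_inter_compactOperators :
    (polarizationPol I : Set (H →L[ℂ] H)) ∩ compactOperators H = {0} :=
  inter_compactOperators_eq_singleton_zero (fun _ => exists_hasSymbol_of_mem_polarizationPol)
    (zero_mem _)

lemma polarization_inter_compactOperators : polarization I ∩ compactOperators H = {0} :=
  inter_compactOperators_eq_singleton_zero (fun _ => exists_hasSymbol_of_mem_polarization)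
    (by simpa using smul_one_mem_polarization (I := I) 0)

lemma coordOp_unitState_diagD_zero (t : UnitDisc) :
    coordOp I 1 1 (unitState I (diagD t 0)) = 0 := by
  rw [(hasSymbol_coordOp I 1 1).hasSymbol_unitState]
  simp [diagD, diagPoint]

/-- The point `1/2` of the unit disc. -/
def discHalf : UnitDisc := UnitDisc.mk 2⁻¹ (by norm_num)

lemma coe_discHalf : (discHalf : ℂ) = 2⁻¹ := rfl

lemma norm_inner_unitState_diagD_discHalf_sq (t : UnitDisc) :
    ‖⟪unitState I (diagD t discHalf), unitState I (diagD t 0)⟫_ℂ‖ ^ 2 = (3 / 4) ^ lam := by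
  have ht : 0 < 1 - ‖(t : ℂ)‖ ^ 2 := sub_pos.2 t.sq_norm_lt_one
  have hker : detKernel (diagD t discHalf) (diagD t 0) = ((1 - ‖(t : ℂ)‖ ^ 2 : ℝ) : ℂ) := by
    rw [diagD, diagD, detKernel_diagPoint, Complex.star_def, Complex.conj_mul']
    simp
  have h := norm_inner_unitState_sq_mul I (diagD t discHalf) (diagD t 0)
  rw [hker, Complex.norm_real, Real.norm_of_nonneg ht.le, weight_diagD, weight_diagD,
    coe_discHalf] at h
  refine mul_right_cancel₀ (pow_pos (pow_pos ht 2) lam).ne' (h.trans ?_)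
  rw [← mul_pow]
  norm_num
  ring

lemma le_norm_star_coordOp_unitState_sq (t : UnitDisc) :
    4⁻¹ * (3 / 4) ^ lam ≤ ‖star (coordOp I 1 1) (unitState I (diagD t 0))‖ ^ 2 := by
  have hadj : ⟪unitState I (diagD t discHalf), star (coordOp I 1 1) (unitState I (diagD t 0))⟫_ℂ =
      2⁻¹ * ⟪unitState I (diagD t discHalf), unitState I (diagD t 0)⟫_ℂ := by
    rw [ContinuousLinearMap.star_eq_adjoint, ContinuousLinearMap.adjoint_inner_right,
      (hasSymbol_coordOp I 1 1).hasSymbol_unitState, inner_smul_left]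
    simp [diagD, diagPoint, coe_discHalf, Complex.conj_ofNat]
  have hle := norm_inner_le_norm (𝕜 := ℂ) (unitState I (diagD t discHalf))
    (star (coordOp I 1 1) (unitState I (diagD t 0)))
  rw [hadj, norm_unitState, one_mul, norm_mul] at hle
  calc 4⁻¹ * (3 / 4) ^ lam = (‖(2⁻¹ : ℂ)‖ *
        ‖⟪unitState I (diagD t discHalf), unitState I (diagD t 0)⟫_ℂ‖) ^ 2 := by
        rw [mul_pow, norm_inner_unitState_diagD_discHalf_sq]
        norm_num
    _ ≤ ‖star (coordOp I 1 1) (unitState I (diagD t 0))‖ ^ 2 := by gcongr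

lemma commutator_coordOp_notMem_compactOperators :
    coordOp I 1 1 * star (coordOp I 1 1) - star (coordOp I 1 1) * coordOp I 1 1 ∉
      compactOperators H := by
  intro hcompact
  set a := coordOp I 1 1
  obtain ⟨r, ⟨hr0, hr1⟩, hr⟩ := exists_radius_forall_norm_apply_unitState_lt (I := I) hcompact
    (show (0 : ℝ) < 4⁻¹ * (3 / 4) ^ lam by positivity)
  let t : UnitDisc := UnitDisc.mk r (by rwa [Complex.norm_real, Real.norm_of_nonneg hr0.le])
  have ht : ‖(t : ℂ)‖ = r := by
    rw [UnitDisc.coe_mk, Complex.norm_real, Real.norm_of_nonneg hr0.le]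
  set u := unitState I (diagD t 0) with hu
  have hau : a u = 0 := coordOp_unitState_diagD_zero I t
  have hinner : ⟪u, (a * star a - star a * a) u⟫_ℂ = ((‖star a u‖ ^ 2 : ℝ) : ℂ) := by
    rw [_root_.sub_apply, mul_apply_eq_comp, mul_apply_eq_comp, hau, map_zero, sub_zero,
      ← ContinuousLinearMap.adjoint_inner_left, ← ContinuousLinearMap.star_eq_adjoint,
      inner_self_eq_norm_sq_to_K]
    simp
  have hle := norm_inner_le_norm (𝕜 := ℂ) u ((a * star a - star a * a) u)
  rw [hinner, hu, norm_unitState, one_mul, ← hu, Complex.norm_real,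
    Real.norm_of_nonneg (sq_nonneg _)] at hle
  exact (hr t ht).not_ge ((le_norm_star_coordOp_unitState_sq I t).trans hle)

lemma linearIndependent_coherentState :
    LinearIndependent ℂ ![coherentState I originD, coherentState I (diagD discHalf 0)] := by
  refine LinearIndependent.pair_iff.2 fun a b hab => ?_
  have hconst : a + b = 0 := by
    simpa [inner_add_right, inner_smul_right, inner_constState] using
      congrArg (fun x => ⟪constState I, x⟫_ℂ) hab
  have hb : b = 0 := by
    have hcoord := congrArg (coordOp I 0 0) hab
    rw [map_add, map_smul, map_smul, hasSymbol_coordOp, hasSymbol_coordOp] at hcoord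
    simpa [originD, diagD, diagPoint, coe_discHalf, coherentState_ne_zero] using hcoord
  exact ⟨by simpa [hb] using hconst, hb⟩

end BoundaryBehaviour

section OperatorAlgebras

variable {lam : ℕ} [Fact (3 < lam)] {H : Type*} [NormedAddCommGroup H] [InnerProductSpace ℂ H]
  [CompleteSpace H] (I : H ≃ₗᵢ⋆[ℂ] bergmanSpace lam) {M : StarSubalgebra ℂ (H →L[ℂ] H)}

lemma actsIrreducibly_of_phaseSpacePol_le (h : phaseSpacePol I ≤ M) :
    ActsIrreducibly (M : Set (H →L[ℂ] H)) :=
  haveI : Nontrivial H := ⟨_, _, coherentState_ne_zero I originD⟩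
  actsIrreducibly_of_rankOne_mem (dense_span_coherentState I)
    fun W Z => h (rankOne_coherentState_mem I W Z)

lemma rankOne_mem_of_phaseSpacePol_le (hM : IsClosed (M : Set (H →L[ℂ] H)))
    (h : phaseSpacePol I ≤ M) (x y : H) : InnerProductSpace.rankOne ℂ x y ∈ M :=
  rankOne_mem_of_dense_span (S := Subalgebra.toSubmodule M.toSubalgebra)
    (dense_span_coherentState I) (dense_span_coherentState I) hM
    (fun W Z => h (rankOne_coherentState_mem I W Z)) x y

lemma stronglyDense_of_phaseSpacePol_le (hM : IsClosed (M : Set (H →L[ℂ] H)))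
    (h : phaseSpacePol I ≤ M) : StronglyDense (M : Set (H →L[ℂ] H)) :=
  stronglyDense_of_rankOne_mem (S := Subalgebra.toSubmodule M.toSubalgebra)
    (rankOne_mem_of_phaseSpacePol_le I hM h)

lemma compactOperators_subset_of_phaseSpacePol_le (hM : IsClosed (M : Set (H →L[ℂ] H)))
    (h : phaseSpacePol I ≤ M) : compactOperators H ⊆ (M : Set (H →L[ℂ] H)) := fun _ hT =>
  mem_of_isCompactOperator (S := Subalgebra.toSubmodule M.toSubalgebra) hM
    (rankOne_mem_of_phaseSpacePol_le I hM h) hT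

lemma compactOperators_subset_idealOperators_of_phaseSpacePol_le
    (hM : IsClosed (M : Set (H →L[ℂ] H))) (h : phaseSpacePol I ≤ M) (J : TwoSidedIdeal M)
    (hJ : IsClosed (J : Set M)) (hirr : ActsIrreducibly (idealOperators J)) :
    compactOperators H ⊆ idealOperators J := by
  have hrank : 2 ≤ Module.rank ℂ H := by
    simpa using (linearIndependent_coherentState I).cardinal_lift_le_rank
  exact compactOperators_subset_idealOperators hM (rankOne_mem_of_phaseSpacePol_le I hM h)
    (Cardinal.one_lt_two.trans_le hrank) hJ hirr

lemma compactOperators_ssubset_commutatorIdeal (hM : IsClosed (M : Set (H →L[ℂ] H)))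
    (h : phaseSpacePol I ≤ M) : compactOperators H ⊂ commutatorIdeal M := by
  let a : M := ⟨coordOp I 1 1, h (coordOp_mem_phaseSpacePol I 1 1)⟩
  have hmem : a * star a - star a * a ∈ TwoSidedIdeal.span {x : M | ∃ a b : M, x = a * b - b * a} :=
    TwoSidedIdeal.subset_span ⟨a, star a, rfl⟩
  have hnot : ((a * star a - star a * a : M) : H →L[ℂ] H) ∉ compactOperators H :=
    commutator_coordOp_notMem_compactOperators I
  have hne : a * star a - star a * a ≠ 0 := fun h0 =>
    hnot (h0 ▸ isCompactOperator_zero)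
  exact (Set.ssubset_iff_of_subset (compactOperators_subset_closure_ideal hM
    (rankOne_mem_of_phaseSpacePol_le I hM h) hmem hne)).2 ⟨_, ⟨_, subset_closure hmem, rfl⟩, hnot⟩

end OperatorAlgebras

end ConformalToeplitz

end

theorem proposition41 (lam : ℕ) [Fact (3 < lam)]
    {H : Type*} [NormedAddCommGroup H] [InnerProductSpace ℂ H] [CompleteSpace H]
    (I : H ≃ₗᵢ⋆[ℂ] bergmanSpace lam) :
    (ActsIrreducibly (phaseSpacePol I : Set (H →L[ℂ] H)) ∧
      (polarizationPol I : Set (H →L[ℂ] H)) ∩ adjointSet (polarizationPol I : Set (H →L[ℂ] H)) =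
        scalarOperators H) ∧
    (WeaklyDense (phaseSpacePol I : Set (H →L[ℂ] H)) ∧
      StronglyDense (phaseSpacePol I : Set (H →L[ℂ] H))) ∧
    (compactOperators H ⊆ (phaseSpacePol I : Set (H →L[ℂ] H)) ∧
      ∀ J : TwoSidedIdeal (phaseSpacePol I), IsClosed (J : Set (phaseSpacePol I)) →
        ActsIrreducibly (idealOperators J) → compactOperators H ⊆ idealOperators J) ∧
    (∃ U : SU22 →* unitary (H →L[ℂ] H), IsDiscreteSeries I U ∧
      ∀ g : SU22, ∀ X ∈ phaseSpacePol I,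
        (U g : H →L[ℂ] H) * X * ContinuousLinearMap.adjoint (U g : H →L[ℂ] H) ∈
          phaseSpacePol I) ∧
    (polarizationPol I : Set (H →L[ℂ] H)) ∩ compactOperators H = {0} ∧
    compactOperators H ⊂ commutatorIdeal (phaseSpacePol I) ∧
    ((ActsIrreducibly (phaseSpace I : Set (H →L[ℂ] H)) ∧
      polarization I ∩ adjointSet (polarization I) = scalarOperators H) ∧
    (WeaklyDense (phaseSpace I : Set (H →L[ℂ] H)) ∧
      StronglyDense (phaseSpace I : Set (H →L[ℂ] H))) ∧
    (compactOperators H ⊆ (phaseSpace I : Set (H →L[ℂ] H)) ∧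
      ∀ J : TwoSidedIdeal (phaseSpace I), IsClosed (J : Set (phaseSpace I)) →
        ActsIrreducibly (idealOperators J) → compactOperators H ⊆ idealOperators J) ∧
    polarization I ∩ compactOperators H = {0} ∧
    compactOperators H ⊂ commutatorIdeal (phaseSpace I)) := by
  have hc := isClosed_phaseSpacePol I
  have hc' := isClosed_phaseSpace I
  have hle := phaseSpacePol_le_phaseSpace I
  exact ⟨⟨actsIrreducibly_of_phaseSpacePol_le I le_rfl, polarizationPol_inter_adjointSet I⟩,
    ⟨weaklyDense_of_stronglyDense (stronglyDense_of_phaseSpacePol_le I hc le_rfl),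
      stronglyDense_of_phaseSpacePol_le I hc le_rfl⟩,
    ⟨compactOperators_subset_of_phaseSpacePol_le I hc le_rfl,
      compactOperators_subset_idealOperators_of_phaseSpacePol_le I hc le_rfl⟩,
    ⟨discreteSeries I, isDiscreteSeries_discreteSeries I,
      fun g X hX => conj_discreteSeries_mem I g hX⟩,
    polarizationPol_inter_compactOperators I,
    compactOperators_ssubset_commutatorIdeal I hc le_rfl,
    ⟨actsIrreducibly_of_phaseSpacePol_le I hle, polarization_inter_adjointSet I⟩,
    ⟨weaklyDense_of_stronglyDense (stronglyDense_of_phaseSpacePol_le I hc' hle),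
      stronglyDense_of_phaseSpacePol_le I hc' hle⟩,
    ⟨compactOperators_subset_of_phaseSpacePol_le I hc' hle,
      compactOperators_subset_idealOperators_of_phaseSpacePol_le I hc' hle⟩,
    polarization_inter_compactOperators I,
    compactOperators_ssubset_commutatorIdeal I hc' hle⟩
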